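/- Let $\Omega\subset\mathbb{R}^n$ be open, $1\le r<\infty$, and let $J=TV:L^r(\Omega)\to[0,\infty]$ be the total variation, $$J(w)=\sup\Big\{\int_\Omega w\,\nabla\cdot q\,dx \;:\; q\in C_c^\infty(\Omega;\mathbb{R}^n),\ |q(x)|\le 1 \text{ for all } x\Big\}.$$ For $u\in L^r(\Omega)$ with $J(u)<\infty$ let $\partial J(u)$ be the set of $p\in L^r(\Omega)^*$ with $J(u)+\langle p,w-u\rangle\le J(w)$ for all $w\in L^r(\Omega)$, let $D_J^p(w,u)=J(w)-J(u)-\langle p,w-u\rangle$ be the Bregman distance, and put $$D_J^p(v,u)\,\square\,D_J^{-p}(v,-u)=\inf_{\varphi,\psi\in L^r(\Omega),\ \varphi+\psi=v}\; D_J^p(\varphi,u)+D_J^{-p}(\psi,-u).$$ Let $v\in C^1(\Omega)\cap L^r(\Omega)$ with $\nabla v\in L^1(\Omega;\mathbb{R}^n)$ (for instance $v\in C^1(\overline\Omega)$ with $\Omega$ bounded). Let $p\in\partial J(u)$ be of the form $p=\nabla\cdot g$ with a measurable vector field $g:\Omega\to\mathbb{R}^n$, $|g|\le 1$ almost everywhere,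 with zero normal component on $\partial\Omega$; that is, $\langle p,w\rangle=-\int_\Omega g\cdot\nabla w\,dx$ for all $w\in C^\infty(\Omega)\cap L^r(\Omega)$ with $\nabla w\in L^1(\Omega;\mathbb{R}^n)$. Then $$\int_\Omega(1-|g|)\,|\nabla v|\,dx\;\le\; D_J^p(v,u)\,\square\,D_J^{-p}(v,-u)\;\le\;\int_\Omega|\nabla v|\,dx-\Big|\int_\Omega\nabla v\cdot g\,dx\Big| .$$ -/

import Mathlib

open MeasureTheory
open scoped ContDiff

noncomputable section

namespace TVBregman

section Convex

variable {E : Type*} [NormedAddCommGroup E] [NormedSpace ℝ E]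

/-- The subdifferential of an extended real valued functional `J` at `u`, a set of continuous
linear functionals. It is empty unless `J u` is finite. -/
def subdifferential (J : E → EReal) (u : E) : Set (StrongDual ℝ E) :=
  {p | J u ≠ ⊤ ∧ J u ≠ ⊥ ∧ ∀ v : E, J u + ((p (v - u) : ℝ) : EReal) ≤ J v}

/-- The Bregman distance `D_J^p(v, u) = J(v) - J(u) - ⟨p, v - u⟩`. -/
def bregman (J : E → EReal) (p : StrongDual ℝ E) (v u : E) : EReal :=
  J v - J u - ((p (v - u) : ℝ) : EReal)

/-- The infimal convolution `(F □ G)(v)`, the infimum of `F(φ) + G(ψ)` over `v = φ + ψ`. -/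
def infConv (F G : E → EReal) (v : E) : EReal :=
  ⨅ (φ : E) (ψ : E) (_ : v = φ + ψ), F φ + G ψ

end Convex

section TotalVariation

variable {n : ℕ}

/-- The divergence `∑ i, ∂ᵢ qᵢ` of a vector field. -/
def divergence (q : EuclideanSpace ℝ (Fin n) → EuclideanSpace ℝ (Fin n))
    (x : EuclideanSpace ℝ (Fin n)) : ℝ :=
  ∑ i : Fin n, (fderiv ℝ q x (EuclideanSpace.single i 1)) i

/-- Smooth vector fields with compact support in `Ω` and pointwise Euclidean norm at most one. -/
def testFields (Ω : Set (EuclideanSpace ℝ (Fin n))) :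
    Set (EuclideanSpace ℝ (Fin n) → EuclideanSpace ℝ (Fin n)) :=
  {q | ContDiff ℝ ∞ q ∧ HasCompactSupport q ∧ tsupport q ⊆ Ω ∧ ∀ x, ‖q x‖ ≤ 1}

/-- The total variation on `L^r(Ω)`, with value `⊤` outside of `BV`. -/
def totalVariation (Ω : Set (EuclideanSpace ℝ (Fin n))) (r : ENNReal)
    (w : Lp ℝ r (volume.restrict Ω)) : EReal :=
  ⨆ q ∈ testFields Ω, ((∫ x in Ω, divergence q x * w x : ℝ) : EReal)

/-- `p = ∇ ⋅ g` in the weak sense and with vanishing normal component of `g` on the boundary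
of `Ω`: the test functions `w` are smooth in `Ω`, but need not vanish at the boundary. -/
def IsDivergenceOf (Ω : Set (EuclideanSpace ℝ (Fin n))) (r : ENNReal) [Fact (1 ≤ r)]
    (p : StrongDual ℝ (Lp ℝ r (volume.restrict Ω)))
    (g : EuclideanSpace ℝ (Fin n) → EuclideanSpace ℝ (Fin n)) : Prop :=
  ∀ (w : EuclideanSpace ℝ (Fin n) → ℝ) (hw : MemLp w r (volume.restrict Ω)),
    ContDiffOn ℝ ∞ w Ω → Integrable (gradient w) (volume.restrict Ω) →
      p (hw.toLp w) = -∫ x in Ω, inner ℝ (g x) (gradient w x)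

end TotalVariation

end TVBregman

end

namespace TVBregman

open Set Filter Topology Metric
open scoped NNReal

set_option linter.unusedSectionVars false

section VariableMollify

variable {E : Type*} [NormedAddCommGroup E] [InnerProductSpace ℝ E] [FiniteDimensional ℝ E]
  [MeasurableSpace E] [BorelSpace E] {F : Type*} [NormedAddCommGroup F] [NormedSpace ℝ F]

/-- A smooth bump function supported in the closed unit ball. -/
noncomputable def mollifierBump : ContDiffBump (0 : E) := ⟨1 / 2, 1, by norm_num, by norm_num⟩

variable (E) in
/-- A smooth probability density on the unit ball, as a measure. -/
noncomputable def mollifier : Measure E :=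
  volume.withDensity fun y => ENNReal.ofReal ((mollifierBump (E := E)).normed volume y)

/-- Averages of `w` around `x` at the scale `δ x`. -/
noncomputable def variableMollify (δ : E → ℝ) (w : E → F) (x : E) : F :=
  ∫ y, w (x - δ x • y) ∂mollifier E

instance : IsProbabilityMeasure (mollifier E) where
  measure_univ := by
    rw [mollifier, withDensity_apply _ MeasurableSet.univ, Measure.restrict_univ,
      ← ofReal_integral_eq_lintegral_ofReal (ContDiffBump.integrable_normed _)
        (Eventually.of_forall (ContDiffBump.nonneg_normed _)), ContDiffBump.integral_normed,
      ENNReal.ofReal_one]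

lemma integral_mollifier (f : E → F) :
    ∫ y, f y ∂mollifier E = ∫ y, (mollifierBump (E := E)).normed volume y • f y := by
  rw [mollifier, integral_withDensity_eq_integral_toReal_smul₀]
  · simp [ENNReal.toReal_ofReal, ContDiffBump.nonneg_normed]
  · exact (ContDiffBump.continuous_normed _).measurable.ennreal_ofReal.aemeasurable
  · exact Eventually.of_forall fun _ => ENNReal.ofReal_lt_top

lemma ae_mollifier_norm_le : ∀ᵐ y ∂mollifier E, ‖y‖ ≤ 1 := by
  rw [mollifier, ae_withDensity_iff
    (ContDiffBump.continuous_normed _).measurable.ennreal_ofReal]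
  refine Eventually.of_forall fun y hy => ?_
  have : y ∈ Function.support ((mollifierBump (E := E)).normed volume) := fun h => hy (by simp [h])
  rw [ContDiffBump.support_normed_eq, mem_ball_zero_iff] at this
  exact this.le

lemma exists_mollifier_le_smul_volume : ∃ C : ENNReal, C ≠ ⊤ ∧ mollifier E ≤ C • volume := by
  obtain ⟨C, hC⟩ := ((mollifierBump (E := E)).hasCompactSupport_normed (μ := volume)
    ).exists_bound_of_continuous (ContDiffBump.continuous_normed _)
  refine ⟨ENNReal.ofReal C, ENNReal.ofReal_ne_top, ?_⟩
  rw [mollifier, ← withDensity_const]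
  exact withDensity_mono (Eventually.of_forall fun y =>
    ENNReal.ofReal_le_ofReal ((le_abs_self _).trans (hC y)))

lemma integrable_mollifier_comp {w : E → F} (hw : LocallyIntegrable w) (x : E) (t : ℝ) :
    Integrable (fun y => w (x - t • y)) (mollifier E) := by
  rcases eq_or_ne t 0 with rfl | ht
  · simp
  obtain ⟨C, hC, hle⟩ := exists_mollifier_le_smul_volume (E := E)
  have h1 : Integrable ((closedBall x |t|).indicator w) :=
    (hw.integrableOn_isCompact (isCompact_closedBall _ _)).integrable_indicator
      isClosed_closedBall.measurableSet
  have h2 : Integrable (fun y => (closedBall x |t|).indicator w (x - t • y)) :=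
    (h1.comp_sub_left x).comp_smul ht
  refine ((h2.smul_measure hC).mono_measure hle).congr ?_
  filter_upwards [ae_mollifier_norm_le] with y hy
  rw [indicator_of_mem]
  simp only [mem_closedBall, dist_eq_norm, sub_sub_cancel_left, norm_neg, norm_smul,
    Real.norm_eq_abs]
  exact mul_le_of_le_one_right (abs_nonneg t) hy

lemma antilipschitz_sub_smul {δ : E → ℝ} {c : ℝ≥0} (hδ : LipschitzWith c δ) (hc : c < 1)
    {y : E} (hy : ‖y‖ ≤ 1) : AntilipschitzWith (1 - c)⁻¹ fun x => x - δ x • y := by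
  have h : LipschitzWith c fun x => -(δ x • y) := by
    refine LipschitzWith.of_dist_le_mul fun a b => ?_
    rw [dist_neg_neg, dist_eq_norm, ← sub_smul, norm_smul]
    refine (mul_le_of_le_one_right (norm_nonneg _) hy).trans ?_
    rw [← dist_eq_norm]
    exact hδ.dist_le_mul a b
  have := (AntilipschitzWith.id (α := E)).add_lipschitzWith h (by simpa using hc)
  simpa [sub_eq_add_neg] using this

lemma volume_preimage_le {K : ℝ≥0} {f : E → E} (hf : AntilipschitzWith K f) (s : Set E) :
    volume (f ⁻¹' s) ≤ (K : ENNReal) ^ Module.finrank ℝ E * volume s := by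
  rw [← InnerProductSpace.euclideanHausdorffMeasure_eq_volume,
    Measure.euclideanHausdorffMeasure_def]
  have := hf.hausdorffMeasure_preimage_le (Nat.cast_nonneg (Module.finrank ℝ E)) s
  simp only [Measure.smul_apply, ENNReal.smul_def, smul_eq_mul, ENNReal.rpow_natCast] at this ⊢
  rw [mul_left_comm]
  gcongr

lemma volume_map_sub_smul_le {δ : E → ℝ} {c : ℝ≥0} (hδ : LipschitzWith c δ) (hc : c < 1)
    {y : E} (hy : ‖y‖ ≤ 1) :
    (volume : Measure E).map (fun x => x - δ x • y) ≤
      (((1 - c)⁻¹ : ℝ≥0) : ENNReal) ^ Module.finrank ℝ E • volume := by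
  have hm : Measurable fun x => x - δ x • y := by
    have := hδ.continuous
    fun_prop
  refine Measure.le_iff.2 fun s hs => ?_
  rw [Measure.map_apply hm hs]
  exact volume_preimage_le (antilipschitz_sub_smul hδ hc hy) s

lemma sub_smul_mem_iff {δ : E → ℝ} {c : ℝ≥0} (hδ : LipschitzWith c δ) (hc : c < 1)
    {y : E} (hy : ‖y‖ ≤ 1) {Ω : Set E} (h0 : ∀ x ∉ Ω, δ x = 0) {x : E} :
    x - δ x • y ∈ Ω ↔ x ∈ Ω := by
  constructor
  · intro h
    by_contra hx
    simp [h0 x hx] at h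
    exact hx h
  · intro h
    by_contra hx
    have := (antilipschitz_sub_smul hδ hc hy).injective (a₁ := x) (a₂ := x - δ x • y)
      (by simp [h0 _ hx])
    exact hx (this ▸ h)

lemma eLpNorm_integral_le {X Y : Type*} [MeasurableSpace X] [MeasurableSpace Y] {μ : Measure X}
    [SFinite μ] {ν : Measure Y} [IsProbabilityMeasure ν] {H : X → Y → F}
    (hH : StronglyMeasurable (Function.uncurry H)) {r : ENNReal} (h1 : 1 ≤ r) (hr : r ≠ ⊤) {C : ENNReal}
    (hC : ∀ᵐ y ∂ν, eLpNorm (fun x => H x y) r μ ≤ C) :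
    eLpNorm (fun x => ∫ y, H x y ∂ν) r μ ≤ C := by
  have h0 : r ≠ 0 := (zero_lt_one.trans_le h1).ne'
  have hr0 : 0 < r.toReal := ENNReal.toReal_pos h0 hr
  have hr1 : 1 ≤ r.toReal := by simpa using ENNReal.toReal_mono hr h1
  rw [eLpNorm_eq_lintegral_rpow_enorm_toReal h0 hr]
  rw [one_div, ENNReal.rpow_inv_le_iff hr0]
  have hpt : ∀ x, ‖∫ y, H x y ∂ν‖ₑ ^ r.toReal ≤ ∫⁻ y, ‖H x y‖ₑ ^ r.toReal ∂ν := by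
    intro x
    have hm : StronglyMeasurable (H x) := hH.comp_measurable (measurable_prodMk_left (x := x))
    have := eLpNorm'_le_eLpNorm'_of_exponent_le zero_lt_one hr1 ν hm.aestronglyMeasurable
    simp only [eLpNorm'_eq_lintegral_enorm, ENNReal.rpow_one, div_one, one_div] at this
    rw [ENNReal.le_rpow_inv_iff hr0] at this
    refine le_trans ?_ this
    gcongr
    exact enorm_integral_le_lintegral_enorm _
  calc ∫⁻ x, ‖∫ y, H x y ∂ν‖ₑ ^ r.toReal ∂μ
      ≤ ∫⁻ x, ∫⁻ y, ‖H x y‖ₑ ^ r.toReal ∂ν ∂μ := lintegral_mono hpt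
    _ = ∫⁻ y, ∫⁻ x, ‖H x y‖ₑ ^ r.toReal ∂μ ∂ν :=
        lintegral_lintegral_swap (hH.enorm.pow_const _).aemeasurable
    _ ≤ ∫⁻ _, C ^ r.toReal ∂ν := by
        refine lintegral_mono_ae ?_
        filter_upwards [hC] with y hy
        rw [eLpNorm_eq_lintegral_rpow_enorm_toReal h0 hr, one_div,
          ENNReal.rpow_inv_le_iff hr0] at hy
        exact hy
    _ = C ^ r.toReal := by simp

lemma eLpNorm_comp_sub_smul_le {δ : E → ℝ} {c : ℝ≥0} (hδ : LipschitzWith c δ) (hc : c < 1)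
    {y : E} (hy : ‖y‖ ≤ 1) {w : E → F} (hw : StronglyMeasurable w) (r : ENNReal) :
    eLpNorm (fun x => w (x - δ x • y)) r volume ≤
      ((((1 - c)⁻¹ : ℝ≥0) : ENNReal) ^ Module.finrank ℝ E) ^ (1 / r).toReal *
        eLpNorm w r volume := by
  have hm : Measurable fun x => x - δ x • y := by
    have := hδ.continuous
    fun_prop
  have := eLpNorm_map_measure (p := r) (μ := (volume : Measure E))
    (f := fun x => x - δ x • y) hw.aestronglyMeasurable hm.aemeasurable
  simp only [Function.comp_def] at this
  rw [← this]
  exact (eLpNorm_mono_measure _ (volume_map_sub_smul_le hδ hc hy)).trans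
    (eLpNorm_smul_measure_le _ _ _ _)

lemma stronglyMeasurable_comp_sub_smul {δ : E → ℝ} (hδ : Continuous δ) {w : E → F}
    (hw : StronglyMeasurable w) :
    StronglyMeasurable (Function.uncurry fun x y => w (x - δ x • y)) :=
  hw.comp_measurable (g := fun z : E × E => z.1 - δ z.1 • z.2)
    (by fun_prop : Continuous fun z : E × E => z.1 - δ z.1 • z.2).measurable

lemma stronglyMeasurable_variableMollify {δ : E → ℝ} (hδ : Continuous δ) {w : E → F}
    (hw : StronglyMeasurable w) : StronglyMeasurable (variableMollify δ w) :=
  (stronglyMeasurable_comp_sub_smul hδ hw).integral_prod_right'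

lemma eLpNorm_variableMollify_le {δ : E → ℝ} {c : ℝ≥0} (hδ : LipschitzWith c δ) (hc : c < 1)
    {w : E → F} (hw : StronglyMeasurable w) {r : ENNReal} (h1 : 1 ≤ r) (hr : r ≠ ⊤) :
    eLpNorm (variableMollify δ w) r volume ≤
      ((((1 - c)⁻¹ : ℝ≥0) : ENNReal) ^ Module.finrank ℝ E) ^ (1 / r).toReal *
        eLpNorm w r volume := by
  refine eLpNorm_integral_le (stronglyMeasurable_comp_sub_smul hδ.continuous hw) h1 hr ?_
  filter_upwards [ae_mollifier_norm_le] with y hy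
  exact eLpNorm_comp_sub_smul_le hδ hc hy hw r

lemma memLp_variableMollify {δ : E → ℝ} {c : ℝ≥0} (hδ : LipschitzWith c δ) (hc : c < 1)
    {w : E → F} (hw : StronglyMeasurable w) {r : ENNReal} (h1 : 1 ≤ r) (hr : r ≠ ⊤)
    (hwr : MemLp w r volume) : MemLp (variableMollify δ w) r volume :=
  ⟨(stronglyMeasurable_variableMollify hδ.continuous hw).aestronglyMeasurable,
    (eLpNorm_variableMollify_le hδ hc hw h1 hr).trans_lt
      (ENNReal.mul_lt_top (ENNReal.rpow_lt_top_of_nonneg ENNReal.toReal_nonneg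
        (ENNReal.pow_ne_top ENNReal.coe_ne_top)) hwr.2)⟩

/-- Small translations of a function in `L^r` are small in `L^r`, for variable shifts too. -/
lemma exists_eLpNorm_comp_sub_smul_sub_le {w : E → F} (hw : StronglyMeasurable w) {r : ENNReal}
    (h1 : 1 ≤ r) (hr : r ≠ ⊤) (hwr : MemLp w r volume) {η : ENNReal} (hη : η ≠ 0) :
    ∃ ε : ℝ, 0 < ε ∧ ∀ δ : E → ℝ, LipschitzWith (1 / 2) δ → (∀ x, |δ x| ≤ ε) →
      ∀ y : E, ‖y‖ ≤ 1 → eLpNorm (fun x => w (x - δ x • y) - w x) r volume ≤ η := by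
  set C : ENNReal := ((((1 - 1 / 2 : ℝ≥0)⁻¹ : ℝ≥0) : ENNReal) ^ Module.finrank ℝ E) ^ (1 / r).toReal
    with hCdef
  have hC : C ≠ ⊤ := ENNReal.rpow_ne_top_of_nonneg ENNReal.toReal_nonneg
    (ENNReal.pow_ne_top ENNReal.coe_ne_top)
  obtain ⟨η₁, hη₁, hη₁'⟩ : ∃ η₁ : ENNReal, η₁ ≠ 0 ∧ (C + 1) * η₁ ≤ η / 2 := by
    refine ⟨(η / 2) / (C + 1), ?_, ENNReal.mul_div_le⟩
    simp [ENNReal.div_eq_zero_iff, hη, hC]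
  obtain ⟨h, hsupp, hh, hcont, hmem⟩ := hwr.exists_hasCompactSupport_eLpNorm_sub_le hr hη₁
  set B := cthickening 1 (tsupport h) with hB
  have hBc : IsCompact B := hsupp.isCompact.cthickening
  set V : ENNReal := volume B ^ (1 / r.toReal) with hV
  have hVt : V ≠ ⊤ := ENNReal.rpow_ne_top_of_nonneg (by positivity) hBc.measure_lt_top.ne
  obtain ⟨κ, hκ0, hκ⟩ : ∃ κ : ℝ≥0, 0 < κ ∧ (κ : ENNReal) * V ≤ η / 2 := by
    obtain ⟨κ, h0, hlt⟩ := ENNReal.exists_nnreal_pos_mul_lt hVt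
      (b := η / 2) (by simp [ENNReal.div_eq_zero_iff, hη])
    exact ⟨κ, h0, hlt.le⟩
  obtain ⟨ε, hε, hεh⟩ := Metric.uniformContinuous_iff.1
    (hsupp.uniformContinuous_of_continuous hcont) κ hκ0
  refine ⟨min (ε / 2) 1, by positivity, fun δ hδ hδε y hy => ?_⟩
  have hhm : StronglyMeasurable h := hcont.stronglyMeasurable
  have hT : Continuous fun x => x - δ x • y := by
    have := hδ.continuous
    fun_prop
  have hhalf : (1 / 2 : ℝ≥0) < 1 := by rw [div_lt_one] <;> norm_num
  have e1 : eLpNorm (fun x => (w - h) (x - δ x • y)) r volume ≤ C * η₁ :=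
    (eLpNorm_comp_sub_smul_le hδ hhalf hy (hw.sub hhm) r).trans (by gcongr)
  have hdist : ∀ x, dist (x - δ x • y) x ≤ min (ε / 2) 1 := fun x => by
    simp only [dist_eq_norm, sub_sub_cancel_left, norm_neg, norm_smul, Real.norm_eq_abs]
    exact (mul_le_of_le_one_right (abs_nonneg _) hy).trans (hδε x)
  have e2 : eLpNorm (fun x => h (x - δ x • y) - h x) r volume ≤ η / 2 := by
    refine le_trans ?_ hκ
    have : eLpNorm (B.indicator fun _ => (κ : ℝ)) r volume ≤ κ * V := by
      refine (eLpNorm_indicator_const_le _ _).trans ?_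
      simp [hV]
    refine le_trans (eLpNorm_mono fun x => ?_) this
    by_cases hx : x ∈ B
    · rw [indicator_of_mem hx, ← dist_eq_norm]
      refine (hεh ((hdist x).trans_lt ?_)).le.trans (le_abs_self _)
      exact (min_le_left _ _).trans_lt (by linarith)
    · have a1 : h x = 0 := by
        by_contra hne
        exact hx (self_subset_cthickening _ (subset_tsupport _ hne))
      have a2 : h (x - δ x • y) = 0 := by
        by_contra hne
        refine hx (mem_cthickening_of_dist_le x _ 1 _ (subset_tsupport _ hne) ?_)
        rw [dist_comm]
        exact (hdist x).trans (min_le_right _ _)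
      simp [a1, a2]
  have hsplit : (fun x => w (x - δ x • y) - w x) =
      (fun x => (w - h) (x - δ x • y)) + ((fun x => h (x - δ x • y) - h x) + (h - w)) := by
    ext x
    simp
  have m1 : AEStronglyMeasurable (fun x => (w - h) (x - δ x • y)) volume :=
    ((hw.sub hhm).comp_measurable hT.measurable).aestronglyMeasurable
  have m2 : AEStronglyMeasurable (fun x => h (x - δ x • y) - h x) volume :=
    ((hcont.comp hT).sub hcont).aestronglyMeasurable
  have m3 : AEStronglyMeasurable (h - w) volume := (hhm.sub hw).aestronglyMeasurable
  rw [hsplit]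
  calc _ ≤ C * η₁ + (η / 2 + η₁) := by
        refine (eLpNorm_add_le m1 (m2.add m3) h1).trans (add_le_add e1 ?_)
        refine (eLpNorm_add_le m2 m3 h1).trans (add_le_add e2 ?_)
        rwa [eLpNorm_sub_comm]
    _ = (C + 1) * η₁ + η / 2 := by ring
    _ ≤ η / 2 + η / 2 := by gcongr
    _ = η := ENNReal.add_halves η

lemma exists_eLpNorm_variableMollify_sub_le [CompleteSpace F] {w : E → F}
    (hw : StronglyMeasurable w) {r : ENNReal}
    (h1 : 1 ≤ r) (hr : r ≠ ⊤) (hwr : MemLp w r volume) {η : ENNReal} (hη : η ≠ 0) :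
    ∃ ε : ℝ, 0 < ε ∧ ∀ δ : E → ℝ, LipschitzWith (1 / 2) δ → (∀ x, |δ x| ≤ ε) →
      eLpNorm (variableMollify δ w - w) r volume ≤ η := by
  obtain ⟨ε, hε, H⟩ := exists_eLpNorm_comp_sub_smul_sub_le hw h1 hr hwr hη
  refine ⟨ε, hε, fun δ hδ hδε => ?_⟩
  have heq : variableMollify δ w - w = fun x => ∫ y, (w (x - δ x • y) - w x) ∂mollifier E := by
    ext x
    rw [integral_sub (integrable_mollifier_comp (hwr.locallyIntegrable h1) x _)
      (integrable_const _)]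
    simp [variableMollify]
  rw [heq]
  refine eLpNorm_integral_le ?_ h1 hr ?_
  · exact (stronglyMeasurable_comp_sub_smul hδ.continuous hw).sub
      (hw.comp_measurable measurable_fst)
  · filter_upwards [ae_mollifier_norm_le] with y hy
    exact H δ hδ hδε y hy

end VariableMollify

section Distance

variable {n : ℕ}

/-- An open set is the support of a nonnegative smooth function which is globally Lipschitz. -/
lemma exists_contDiff_lipschitz_support_eq {Ω : Set (EuclideanSpace ℝ (Fin n))} (hΩ : IsOpen Ω) :
    ∃ d : EuclideanSpace ℝ (Fin n) → ℝ, ContDiff ℝ ∞ d ∧ LipschitzWith 1 d ∧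
      Function.support d = Ω ∧ ∀ x, 0 ≤ d x ∧ d x ≤ 1 := by
  set G : EuclideanSpace ℝ (Fin n) → EuclideanSpace ℝ (Fin n) :=
    fun x => WithLp.toLp 2 fun i => Real.arctan (x i) with hG
  set H : EuclideanSpace ℝ (Fin n) → EuclideanSpace ℝ (Fin n) :=
    fun x => WithLp.toLp 2 fun i => Real.tan (x i) with hH
  set Q : Set (EuclideanSpace ℝ (Fin n)) :=
    ⋂ i, (fun x => x i) ⁻¹' Ioo (-(Real.pi / 2)) (Real.pi / 2) with hQ
  have hQo : IsOpen Q := isOpen_iInter_of_finite fun i => isOpen_Ioo.preimage (by fun_prop)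
  have hHc : ContinuousOn H Q := by
    refine (PiLp.continuous_toLp 2 _).comp_continuousOn (continuousOn_pi.2 fun i => ?_)
    exact Real.continuousOn_tan_Ioo.comp (by fun_prop) fun x hx => mem_iInter.1 hx i
  obtain ⟨f, hfs, hf, hfr⟩ := (hHc.isOpen_inter_preimage hQo hΩ).exists_contDiff_support_eq
    (n := (⊤ : ℕ∞))
  have hfc : HasCompactSupport f := by
    refine HasCompactSupport.of_support_subset_isCompact (K := WithLp.toLp 2 ''
      (univ.pi fun _ : Fin n => Icc (-(Real.pi / 2)) (Real.pi / 2)))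
      ((isCompact_univ_pi fun _ => isCompact_Icc).image (PiLp.continuous_toLp 2 _)) ?_
    rw [hfs]
    rintro x ⟨hx, -⟩
    exact ⟨WithLp.ofLp x, fun i _ => Ioo_subset_Icc_self (mem_iInter.1 hx i), rfl⟩
  obtain ⟨C, hC⟩ := hf.lipschitzWith_of_hasCompactSupport hfc (by simp)
  have hGL : LipschitzWith 1 G := by
    have harc : LipschitzWith 1 Real.arctan := by
      refine lipschitzWith_of_nnnorm_deriv_le Real.differentiable_arctan fun x => ?_
      rw [← NNReal.coe_le_coe, coe_nnnorm, Real.deriv_arctan, Real.norm_eq_abs,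
        abs_of_nonneg (by positivity), NNReal.coe_one, div_le_one (by positivity)]
      nlinarith [sq_nonneg x]
    refine LipschitzWith.of_dist_le_mul fun x y => ?_
    rw [NNReal.coe_one, one_mul, EuclideanSpace.dist_eq, EuclideanSpace.dist_eq]
    refine Real.sqrt_le_sqrt (Finset.sum_le_sum fun i _ => ?_)
    have := harc.dist_le_mul (x i) (y i)
    simp only [NNReal.coe_one, one_mul] at this
    simp only [hG]
    gcongr
  have hGs : ContDiff ℝ ∞ G := contDiff_euclidean.2 fun i =>
    Real.contDiff_arctan.comp (contDiff_euclidean.1 contDiff_id i)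
  have hpos : 0 < (C : ℝ) + 1 := by positivity
  refine ⟨fun x => (C + 1 : ℝ)⁻¹ * f (G x), contDiff_const.mul (hf.comp hGs), ?_, ?_, fun x => ?_⟩
  · refine LipschitzWith.of_dist_le_mul fun x y => ?_
    have h1 := (hC.comp hGL).dist_le_mul x y
    rw [Real.dist_eq] at h1 ⊢
    simp only [mul_one, Function.comp_apply, NNReal.coe_one, one_mul] at h1 ⊢
    rw [← mul_sub, abs_mul, abs_of_pos (inv_pos.2 hpos), inv_mul_le_iff₀ hpos]
    nlinarith [dist_nonneg (x := x) (y := y)]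
  · ext x
    have h1 : x ∈ Function.support (fun x => (C + 1 : ℝ)⁻¹ * f (G x)) ↔
        G x ∈ Function.support f := by
      simp [Function.mem_support, hpos.ne']
    rw [h1, hfs]
    have h2 : G x ∈ Q := mem_iInter.2 fun i => Real.arctan_mem_Ioo _
    have h3 : H (G x) = x := by
      ext i
      simp [hH, hG]
    simp [h2, h3]
  · have := hfr ⟨G x, rfl⟩
    exact ⟨mul_nonneg (inv_pos.2 hpos).le this.1,
      (inv_mul_le_iff₀ hpos).2 (by linarith [this.2, C.coe_nonneg])⟩

end Distance

section Smoothness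

variable {E : Type*} [NormedAddCommGroup E] [InnerProductSpace ℝ E] [FiniteDimensional ℝ E]
  [MeasurableSpace E] [BorelSpace E] {F : Type*} [NormedAddCommGroup F] [NormedSpace ℝ F]

lemma mollifier_restrict_closedBall :
    (mollifier E).restrict (closedBall 0 1) = mollifier E := by
  refine Measure.restrict_eq_self_of_ae_mem ?_
  filter_upwards [ae_mollifier_norm_le] with y hy
  simpa using hy

lemma integrable_mollifier_of_continuousOn {f : E → F} (hf : ContinuousOn f (closedBall 0 1)) :
    Integrable f (mollifier E) := by
  rw [← mollifier_restrict_closedBall]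
  exact hf.integrableOn_compact (isCompact_closedBall _ _)

/-- The smooth kernel of `variableMollify`. -/
noncomputable def mollifierKernel (t : ℝ) (z : E) : ℝ :=
  |t ^ Module.finrank ℝ E|⁻¹ * (mollifierBump (E := E)).normed volume (t⁻¹ • z)

lemma variableMollify_eq_convolution {δ : E → ℝ} {w : E → F} {x : E} (hx : δ x ≠ 0) :
    variableMollify δ w x =
      convolution w (mollifierKernel (δ x)) (ContinuousLinearMap.lsmul ℝ ℝ).flip volume x := by
  rw [variableMollify, integral_mollifier, convolution_def]
  have h1 := Measure.integral_comp_smul (volume : Measure E)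
    (fun z => (mollifierBump (E := E)).normed volume ((δ x)⁻¹ • z) • w (x - z)) (δ x)
  have h2 := integral_sub_left_eq_self
    (fun z => (mollifierBump (E := E)).normed volume ((δ x)⁻¹ • z) • w (x - z))
    (volume : Measure E) x
  simp only [smul_smul, inv_mul_cancel₀ hx, one_smul] at h1
  rw [h1, ← h2, ← integral_smul]
  simp only [sub_sub_cancel, ContinuousLinearMap.flip_apply, ContinuousLinearMap.lsmul_apply,
    mollifierKernel, smul_smul, abs_inv]

lemma variableMollify_congr_ae {δ : E → ℝ} {w w' : E → F} (h : w =ᵐ[volume] w') {x : E}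
    (hx : δ x ≠ 0) : variableMollify δ w x = variableMollify δ w' x := by
  rw [variableMollify_eq_convolution hx, variableMollify_eq_convolution hx]
  refine integral_congr_ae ?_
  filter_upwards [h] with y hy
  rw [hy]

lemma contDiffOn_variableMollify [CompleteSpace F] {Ω : Set E} {δ : E → ℝ} (hδ : ContDiff ℝ ∞ δ)
    (hpos : ∀ x ∈ Ω, 0 < δ x ∧ δ x < 1) {w : E → F} (hw : LocallyIntegrable w) :
    ContDiffOn ℝ ∞ (variableMollify δ w) Ω := by
  have hg : ContDiffOn ℝ ∞ (Function.uncurry (mollifierKernel (E := E)))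
      (Ioo (0 : ℝ) 1 ×ˢ univ) := by
    have hinv : ContDiffOn ℝ ∞ (fun z : ℝ × E => z.1⁻¹) (Ioo (0 : ℝ) 1 ×ˢ univ) :=
      contDiffOn_fst.inv fun z hz => hz.1.1.ne'
    have h1 : ContDiffOn ℝ ∞ (fun z : ℝ × E => (z.1 ^ Module.finrank ℝ E)⁻¹ *
        (mollifierBump (E := E)).normed volume (z.1⁻¹ • z.2)) (Ioo (0 : ℝ) 1 ×ˢ univ) := by
      refine ContDiffOn.mul ((contDiffOn_fst.pow _).inv fun z hz => (pow_pos hz.1.1 _).ne') ?_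
      exact ((ContDiffBump.contDiff_normed _).comp_contDiffOn (hinv.smul contDiffOn_snd))
    refine h1.congr fun z hz => ?_
    simp only [Function.uncurry, mollifierKernel]
    rw [abs_of_pos (pow_pos hz.1.1 _)]
  have hsupp : ∀ (t : ℝ) (z : E), t ∈ Ioo (0 : ℝ) 1 → z ∉ closedBall (0 : E) 1 →
      mollifierKernel t z = 0 := by
    intro t z ht hz
    have : (mollifierBump (E := E)).normed volume (t⁻¹ • z) = 0 := by
      rw [← Function.notMem_support, ContDiffBump.support_normed_eq, mem_ball_zero_iff, norm_smul,
        Real.norm_eq_abs, abs_of_pos (inv_pos.2 ht.1), not_lt]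
      rw [mem_closedBall_zero_iff, not_le] at hz
      change 1 ≤ _
      rw [← div_eq_inv_mul, one_le_div ht.1]
      exact ht.2.le.trans hz.le
    simp [mollifierKernel, this]
  have key := contDiffOn_convolution_right_with_param (n := (⊤ : ℕ∞)) (μ := (volume : Measure E))
    (ContinuousLinearMap.lsmul ℝ ℝ : ℝ →L[ℝ] F →L[ℝ] F).flip isOpen_Ioo
    (isCompact_closedBall (0 : E) 1) hsupp hw hg
  have hcomp : ContDiffOn ℝ ∞ (fun x => (δ x, x)) Ω := (hδ.prodMk contDiff_id).contDiffOn
  refine (key.comp hcomp fun x hx => ⟨hpos x hx, mem_univ _⟩).congr fun x hx => ?_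
  exact variableMollify_eq_convolution (hpos x hx).1.ne'

/-- The differential of `x ↦ w (x - δ x • y)`. -/
noncomputable def stepFDeriv (δ : E → ℝ) (w : E → F) (x y : E) : E →L[ℝ] F :=
  (fderiv ℝ w (x - δ x • y)).comp
    (ContinuousLinearMap.id ℝ E - (fderiv ℝ δ x).smulRight y)

lemma continuousOn_stepFDeriv {Ω : Set E} (hΩ : IsOpen Ω) {δ : E → ℝ} (hδ : ContDiff ℝ 1 δ)
    (hmem : ∀ x ∈ Ω, ∀ y : E, ‖y‖ ≤ 1 → x - δ x • y ∈ Ω) {w : E → F} (hw : ContDiffOn ℝ 1 w Ω) :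
    ContinuousOn (Function.uncurry (stepFDeriv δ w)) (Ω ×ˢ closedBall 0 1) := by
  have hc : Continuous δ := hδ.continuous
  have h1 : Continuous fun z : E × E => z.1 - δ z.1 • z.2 := by fun_prop
  have h2 : ContinuousOn (fun z : E × E => fderiv ℝ w (z.1 - δ z.1 • z.2))
      (Ω ×ˢ closedBall 0 1) :=
    (hw.continuousOn_fderiv_of_isOpen hΩ le_rfl).comp h1.continuousOn fun z hz =>
      hmem _ hz.1 _ (by simpa using hz.2)
  have h3 : Continuous fun z : E × E => (fderiv ℝ δ z.1).smulRight z.2 :=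
    ((ContinuousLinearMap.smulRightL ℝ E E).continuous.comp
      ((hδ.continuous_fderiv one_ne_zero).comp continuous_fst)).clm_apply continuous_snd
  exact h2.clm_comp (continuous_const.sub h3).continuousOn

lemma hasFDerivAt_variableMollify {Ω : Set E} (hΩ : IsOpen Ω) {δ : E → ℝ}
    (hδ : ContDiff ℝ 1 δ) (hmem : ∀ x ∈ Ω, ∀ y : E, ‖y‖ ≤ 1 → x - δ x • y ∈ Ω) {w : E → F}
    (hwm : StronglyMeasurable w) (hwi : LocallyIntegrable w) (hw : ContDiffOn ℝ 1 w Ω)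
    {x : E} (hx : x ∈ Ω) :
    HasFDerivAt (variableMollify δ w) (∫ y, stepFDeriv δ w x y ∂mollifier E) x := by
  obtain ⟨ε, hε, hεΩ⟩ := Metric.nhds_basis_closedBall.mem_iff.1 (hΩ.mem_nhds hx)
  have hcont := continuousOn_stepFDeriv hΩ hδ hmem hw
  obtain ⟨C, hC⟩ := ((isCompact_closedBall x ε).prod
    (isCompact_closedBall (0 : E) 1)).exists_bound_of_continuousOn
    (hcont.mono (prod_mono hεΩ subset_rfl))
  have hc : Continuous δ := hδ.continuous
  refine hasFDerivAt_integral_of_dominated_of_fderiv_le (bound := fun _ => C)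
    (closedBall_mem_nhds x hε) (Eventually.of_forall fun z => ?_)
    (integrable_mollifier_comp hwi x (δ x)) ?_ ?_ (integrable_const _) ?_
  · exact (hwm.comp_measurable
      (by fun_prop : Continuous fun y => z - δ z • y).measurable).aestronglyMeasurable
  · refine (integrable_mollifier_of_continuousOn ?_).aestronglyMeasurable
    exact hcont.comp (f := fun y => (x, y)) (by fun_prop) fun y hy => ⟨hx, hy⟩
  · filter_upwards [ae_mollifier_norm_le] with y hy z hz
    exact hC (z, y) ⟨hz, by simpa using hy⟩
  · filter_upwards [ae_mollifier_norm_le] with y hy z hz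
    have hd : HasFDerivAt w (fderiv ℝ w (z - δ z • y)) (z - δ z • y) :=
      ((hw.contDiffAt (hΩ.mem_nhds (hmem z (hεΩ hz) y hy))).differentiableAt
        one_ne_zero).hasFDerivAt
    exact hd.comp z ((hasFDerivAt_id z).sub
      ((hδ.differentiable one_ne_zero z).hasFDerivAt.smul_const y))

/-- Up to a small error, the gradient commutes with mollification at a variable scale. -/
lemma norm_gradient_variableMollify_sub_le {Ω : Set E} (hΩ : IsOpen Ω) {δ : E → ℝ} {c : ℝ≥0}
    (hδ : ContDiff ℝ 1 δ) (hL : LipschitzWith c δ)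
    (hmem : ∀ x ∈ Ω, ∀ y : E, ‖y‖ ≤ 1 → x - δ x • y ∈ Ω) {w : E → ℝ}
    (hwm : StronglyMeasurable w) (hwi : LocallyIntegrable w) (hw : ContDiffOn ℝ 1 w Ω)
    {x : E} (hx : x ∈ Ω) :
    ‖gradient (variableMollify δ w) x - variableMollify δ (gradient w) x‖ ≤
      c * variableMollify δ (fun z => ‖gradient w z‖) x := by
  have hder := hasFDerivAt_variableMollify hΩ hδ hmem hwm hwi hw hx
  have hcd : Continuous δ := hδ.continuous
  have hint : Integrable (stepFDeriv δ w x) (mollifier E) :=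
    integrable_mollifier_of_continuousOn ((continuousOn_stepFDeriv hΩ hδ hmem hw).comp
      (f := fun y => (x, y)) (by fun_prop) fun y hy => ⟨hx, hy⟩)
  have hgc : ContinuousOn (gradient w) Ω :=
    (InnerProductSpace.toDual ℝ E).symm.continuous.comp_continuousOn
      (hw.continuousOn_fderiv_of_isOpen hΩ le_rfl)
  have hgT : ContinuousOn (fun y => gradient w (x - δ x • y)) (closedBall 0 1) :=
    hgc.comp (by fun_prop) fun y hy => hmem x hx y (by simpa using hy)
  have hgi : Integrable (fun y => gradient w (x - δ x • y)) (mollifier E) :=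
    integrable_mollifier_of_continuousOn hgT
  have hyi : Integrable (fun y => inner ℝ (gradient w (x - δ x • y)) y) (mollifier E) :=
    integrable_mollifier_of_continuousOn (hgT.inner continuousOn_id)
  set D := gradient (variableMollify δ w) x - variableMollify δ (gradient w) x with hD
  have key : ∀ e : E, inner ℝ D e =
      -(fderiv ℝ δ x e * ∫ y, inner ℝ (gradient w (x - δ x • y)) y ∂mollifier E) := by
    intro e
    have h1 : inner ℝ (gradient (variableMollify δ w) x) e =
        ∫ y, stepFDeriv δ w x y e ∂mollifier E := by
      rw [inner_gradient_left, hder.fderiv, ContinuousLinearMap.integral_apply hint]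
    have h2 : inner ℝ (variableMollify δ (gradient w) x) e =
        ∫ y, inner ℝ (gradient w (x - δ x • y)) e ∂mollifier E := by
      rw [variableMollify, real_inner_comm, ← integral_inner hgi]
      simp only [real_inner_comm]
    have h3 : ∀ y, stepFDeriv δ w x y e = inner ℝ (gradient w (x - δ x • y)) e -
        fderiv ℝ δ x e * inner ℝ (gradient w (x - δ x • y)) y := by
      intro y
      simp [stepFDeriv, inner_gradient_left]
    rw [hD, inner_sub_left, h1, h2]
    simp only [h3]
    rw [integral_sub (hgi.inner_const e) (hyi.const_mul _), integral_const_mul]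
    ring
  have hbound : |∫ y, inner ℝ (gradient w (x - δ x • y)) y ∂mollifier E| ≤
      variableMollify δ (fun z => ‖gradient w z‖) x := by
    rw [← Real.norm_eq_abs]
    refine norm_integral_le_of_norm_le hgi.norm ?_
    filter_upwards [ae_mollifier_norm_le] with y hy
    exact (norm_inner_le_norm _ _).trans (mul_le_of_le_one_right (norm_nonneg _) hy)
  have hfd : ‖fderiv ℝ δ x‖ ≤ c := norm_fderiv_le_of_lipschitz ℝ hL
  have hle : ‖D‖ * ‖D‖ ≤ (c * variableMollify δ (fun z => ‖gradient w z‖) x) * ‖D‖ := by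
    rw [← real_inner_self_eq_norm_mul_norm, key D]
    refine (neg_le_abs _).trans ?_
    rw [abs_mul]
    calc _ ≤ (c * ‖D‖) * variableMollify δ (fun z => ‖gradient w z‖) x := by
          gcongr
          rw [← Real.norm_eq_abs]
          exact ((fderiv ℝ δ x).le_opNorm D).trans (by gcongr)
      _ = _ := by ring
  rcases (norm_nonneg D).eq_or_lt with h | h
  · rw [← h]
    exact mul_nonneg c.2 (integral_nonneg fun _ => norm_nonneg _)
  · exact le_of_mul_le_mul_right hle h

end Smoothness

section Divergence

variable {n : ℕ}

lemma continuous_divergence {q : EuclideanSpace ℝ (Fin n) → EuclideanSpace ℝ (Fin n)}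
    (hq : ContDiff ℝ 1 q) : Continuous (divergence q) := by
  have := hq.continuous_fderiv one_ne_zero
  unfold divergence
  fun_prop

lemma divergence_eq_zero {q : EuclideanSpace ℝ (Fin n) → EuclideanSpace ℝ (Fin n)}
    {x : EuclideanSpace ℝ (Fin n)} (hx : x ∉ tsupport q) : divergence q x = 0 := by
  have : fderiv ℝ q x = 0 := by
    by_contra h
    exact hx (support_fderiv_subset ℝ h)
  simp [divergence, this]

lemma hasCompactSupport_divergence {q : EuclideanSpace ℝ (Fin n) → EuclideanSpace ℝ (Fin n)}
    (hq : HasCompactSupport q) : HasCompactSupport (divergence q) :=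
  HasCompactSupport.intro hq fun _ hx => divergence_eq_zero hx

lemma setIntegral_divergence_mul {Ω : Set (EuclideanSpace ℝ (Fin n))}
    {q : EuclideanSpace ℝ (Fin n) → EuclideanSpace ℝ (Fin n)} (hq : tsupport q ⊆ Ω)
    (f : EuclideanSpace ℝ (Fin n) → ℝ) :
    ∫ x in Ω, divergence q x * f x = ∫ x, divergence q x * f x :=
  setIntegral_eq_integral_of_forall_compl_eq_zero fun x hx => by
    rw [divergence_eq_zero fun h => hx (hq h), zero_mul]

/-- The divergence theorem for compactly supported vector fields. -/
lemma setIntegral_divergence_mul_eq {U : Set (EuclideanSpace ℝ (Fin n))} (hU : IsOpen U)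
    {f : EuclideanSpace ℝ (Fin n) → ℝ} (hf : ContDiffOn ℝ 1 f U)
    {q : EuclideanSpace ℝ (Fin n) → EuclideanSpace ℝ (Fin n)} (hq : ContDiff ℝ 1 q)
    (hqc : HasCompactSupport q) (hqU : tsupport q ⊆ U) :
    ∫ x in U, divergence q x * f x = -∫ x in U, inner ℝ (gradient f x) (q x) := by
  have hint : ∀ {h : EuclideanSpace ℝ (Fin n) → ℝ}, ContinuousOn h U →
      (∀ x ∉ tsupport q, h x = 0) → Integrable h := fun hc h0 =>
    ((hc.mono hqU).integrableOn_compact hqc).integrable_of_forall_notMem_eq_zero h0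
  have hfc : ContinuousOn f U := hf.continuousOn
  have hf' : ContinuousOn (fderiv ℝ f) U := hf.continuousOn_fderiv_of_isOpen hU le_rfl
  have hqi : ∀ i, ContDiff ℝ 1 fun x => q x i := contDiff_euclidean.1 hq
  have hsub : ∀ i, tsupport (fun x => q x i) ⊆ tsupport q := fun i =>
    closure_mono fun x hx h => hx (by simp [h])
  have hq0 : ∀ i, ∀ x ∉ tsupport q, q x i = 0 := fun i x hx => by
    simp [image_eq_zero_of_notMem_tsupport hx]
  have hfd : ∀ i x, fderiv ℝ (fun x => q x i) x (EuclideanSpace.single i 1) =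
      (fderiv ℝ q x (EuclideanSpace.single i 1)) i := fun i x => by
    have := (((EuclideanSpace.proj i : EuclideanSpace ℝ (Fin n) →L[ℝ] ℝ).hasFDerivAt
      (x := q x)).comp x ((hq.differentiable one_ne_zero x).hasFDerivAt)).fderiv
    simp only [Function.comp_def, PiLp.proj_apply] at this
    rw [this]
    simp
  have hint1 : ∀ i, Integrable fun x =>
      f x * fderiv ℝ (fun x => q x i) x (EuclideanSpace.single i 1) := fun i => by
    refine hint ?_ fun x hx => ?_
    · have := (hqi i).continuous_fderiv one_ne_zero
      exact hfc.mul (by fun_prop)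
    · have h0 : fderiv ℝ (fun x => q x i) x = 0 := by
        by_contra h
        exact hx (hsub i (support_fderiv_subset ℝ h))
      simp [h0]
  have hint2 : ∀ i, Integrable fun x =>
      fderiv ℝ f x (EuclideanSpace.single i 1) * q x i := fun i =>
    hint ((hf'.clm_apply continuousOn_const).mul (hqi i).continuous.continuousOn)
      fun x hx => by simp [hq0 i x hx]
  have hparts : ∀ i, ∫ x, f x * fderiv ℝ (fun x => q x i) x (EuclideanSpace.single i 1) =
      -∫ x, fderiv ℝ f x (EuclideanSpace.single i 1) * q x i := fun i =>
    integral_mul_fderiv_eq_neg_fderiv_mul_of_integrable (hint2 i) (hint1 i)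
      (hint (hfc.mul (hqi i).continuous.continuousOn) fun x hx => by simp [hq0 i x hx])
      (fun x hx => (hf.contDiffAt (hU.mem_nhds (hqU (hsub i hx)))).differentiableAt one_ne_zero)
      (fun x _ => (hqi i).differentiable one_ne_zero x)
  have hinner : ∀ x, inner ℝ (gradient f x) (q x) =
      ∑ i, fderiv ℝ f x (EuclideanSpace.single i 1) * q x i := fun x => by
    rw [PiLp.inner_apply]
    refine Finset.sum_congr rfl fun i _ => ?_
    rw [← inner_gradient_left, EuclideanSpace.inner_single_right]
    simp [mul_comm]
  rw [setIntegral_divergence_mul hqU, setIntegral_eq_integral_of_forall_compl_eq_zero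
    fun x hx => by rw [image_eq_zero_of_notMem_tsupport fun h => hx (hqU h), inner_zero_right]]
  simp only [hinner]
  rw [integral_finsetSum _ fun i _ => hint2 i, ← Finset.sum_neg_distrib]
  simp only [← hparts]
  rw [← integral_finsetSum _ fun i _ => hint1 i]
  refine integral_congr_ae (Eventually.of_forall fun x => ?_)
  simp only [divergence, Finset.sum_mul, hfd]
  exact Finset.sum_congr rfl fun i _ => mul_comm _ _

lemma exists_contDiff_cutoff {U : Set (EuclideanSpace ℝ (Fin n))} (hU : IsOpen U) :
    ∃ χ : ℕ → EuclideanSpace ℝ (Fin n) → ℝ,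
      (∀ k, ContDiff ℝ ∞ (χ k) ∧ HasCompactSupport (χ k) ∧ tsupport (χ k) ⊆ U ∧
        ∀ x, 0 ≤ χ k x ∧ χ k x ≤ 1) ∧ ∀ x ∈ U, ∀ᶠ k in atTop, χ k x = 1 := by
  obtain ⟨d, hd, -, hds, hd01⟩ := exists_contDiff_lipschitz_support_eq hU
  let b : ℕ → ContDiffBump (0 : EuclideanSpace ℝ (Fin n)) := fun k =>
    ⟨k + 1, k + 2, by positivity, by linarith⟩
  have hclosed : ∀ k : ℕ, IsClosed {x | 1 ≤ (k : ℝ) * d x} := fun k =>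
    isClosed_le continuous_const (continuous_const.mul hd.continuous)
  have hsub : ∀ k : ℕ, tsupport (fun x => Real.smoothTransition (k * d x - 1) * b k x) ⊆
      {x | 1 ≤ (k : ℝ) * d x} := fun k => by
    refine closure_minimal (fun x hx => ?_) (hclosed k)
    by_contra h
    simp only [mem_ofPred_eq, not_le] at h
    exact hx (by simp [Real.smoothTransition.zero_of_nonpos (x := k * d x - 1) (by linarith)])
  refine ⟨fun k x => Real.smoothTransition (k * d x - 1) * b k x, fun k => ⟨?_, ?_, ?_, ?_⟩, ?_⟩
  · exact (Real.smoothTransition.contDiff.comp ((contDiff_const.mul hd).sub contDiff_const)).mul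
      (b k).contDiff
  · exact (b k).hasCompactSupport.mul_left
  · refine (hsub k).trans fun x hx => ?_
    rw [← hds]
    intro h
    simp only [mem_ofPred_eq, h, mul_zero] at hx
    linarith
  · intro x
    exact ⟨mul_nonneg (Real.smoothTransition.nonneg _) (b k).nonneg,
      mul_le_one₀ (Real.smoothTransition.le_one _) (b k).nonneg (b k).le_one⟩
  · intro x hx
    have hdx : 0 < d x := lt_of_le_of_ne (hd01 x).1 (Ne.symm (by rw [← hds] at hx; exact hx))
    obtain ⟨N, hN⟩ := exists_nat_ge (max (2 / d x) ‖x‖)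
    filter_upwards [eventually_ge_atTop N] with k hk
    have hkN : (N : ℝ) ≤ k := Nat.cast_le.2 hk
    have h1 : 2 / d x ≤ k := (le_max_left _ _).trans (hN.trans hkN)
    have h2 : ‖x‖ ≤ k := (le_max_right _ _).trans (hN.trans hkN)
    rw [div_le_iff₀ hdx] at h1
    rw [Real.smoothTransition.one_of_one_le (by linarith), one_mul]
    refine (b k).one_of_mem_closedBall ?_
    rw [mem_closedBall_zero_iff]
    exact h2.trans (by simp [b])

lemma contDiffOn_gradient {U : Set (EuclideanSpace ℝ (Fin n))} (hU : IsOpen U)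
    {f : EuclideanSpace ℝ (Fin n) → ℝ} (hf : ContDiffOn ℝ ∞ f U) :
    ContDiffOn ℝ ∞ (gradient f) U := by
  refine contDiffOn_euclidean.2 fun i => ?_
  have : (fun x => gradient f x i) = fun x => fderiv ℝ f x (EuclideanSpace.single i 1) := by
    ext x
    rw [← inner_gradient_left, EuclideanSpace.inner_single_right]
    simp
  rw [this]
  exact (hf.fderiv_of_isOpen hU (by simp)).clm_apply contDiffOn_const

/-- The total variation of a smooth function dominates the integral of its gradient. -/
lemma lintegral_gradient_le {U : Set (EuclideanSpace ℝ (Fin n))} (hU : IsOpen U)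
    {f : EuclideanSpace ℝ (Fin n) → ℝ} (hf : ContDiffOn ℝ ∞ f U) {M : ℝ}
    (hM : ∀ q ∈ testFields U, ∫ x in U, divergence q x * f x ≤ M) :
    ∫⁻ x in U, ‖gradient f x‖ₑ ≤ ENNReal.ofReal M := by
  obtain ⟨χ, hχ, hχ1⟩ := exists_contDiff_cutoff hU
  set G := gradient f with hG
  have hGs : ContDiffOn ℝ ∞ G U := contDiffOn_gradient hU hf
  set s : ℕ → EuclideanSpace ℝ (Fin n) → ℝ :=
    fun k x => (Real.sqrt (‖G x‖ ^ 2 + (1 / ((k : ℝ) + 1)) ^ 2))⁻¹ with hs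
  have harg : ∀ (k : ℕ) x, 0 < ‖G x‖ ^ 2 + (1 / ((k : ℝ) + 1)) ^ 2 := fun k x => by positivity
  have hs0 : ∀ k x, 0 < s k x := fun k x => inv_pos.2 (Real.sqrt_pos.2 (harg k x))
  have hsG : ∀ k x, s k x * ‖G x‖ ≤ 1 := fun k x => by
    rw [hs]
    simp only
    rw [inv_mul_le_iff₀ (Real.sqrt_pos.2 (harg k x)), mul_one]
    refine Real.le_sqrt_of_sq_le ?_
    linarith [sq_nonneg (1 / ((k : ℝ) + 1))]
  have hss : ∀ k, ContDiffOn ℝ ∞ (s k) U := fun k =>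
    (((hGs.norm_sq ℝ).add contDiffOn_const).sqrt fun x _ => (harg k x).ne').inv
      fun x _ => (Real.sqrt_pos.2 (harg k x)).ne'
  set q : ℕ → EuclideanSpace ℝ (Fin n) → EuclideanSpace ℝ (Fin n) :=
    fun k x => χ k x • (-(s k x • G x)) with hq
  have hqt : ∀ k, tsupport (q k) ⊆ tsupport (χ k) := fun k => tsupport_smul_subset_left _ _
  have hqs : ∀ k, ContDiff ℝ ∞ (q k) := fun k => by
    refine contDiff_iff_contDiffAt.2 fun x => ?_
    by_cases hx : x ∉ tsupport (q k)
    · exact contDiffAt_const.congr_of_eventuallyEq (notMem_tsupport_iff_eventuallyEq.1 hx)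
    rw [not_not] at hx
    have hxU := hU.mem_nhds ((hχ k).2.2.1 (hqt k hx))
    exact (hχ k).1.contDiffAt.smul (((hss k).smul hGs).neg.contDiffAt hxU)
  have hqm : ∀ k, q k ∈ testFields U := fun k => by
    refine ⟨hqs k, (hχ k).2.1.mono' ((subset_tsupport _).trans (hqt k)),
      (hqt k).trans (hχ k).2.2.1, fun x => ?_⟩
    rw [hq]
    simp only
    rw [norm_smul, norm_neg, norm_smul, Real.norm_eq_abs, Real.norm_eq_abs, abs_of_pos (hs0 k x),
      abs_of_nonneg ((hχ k).2.2.2 x).1]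
    exact mul_le_one₀ ((hχ k).2.2.2 x).2 (mul_nonneg (hs0 k x).le (norm_nonneg _)) (hsG k x)
  set h : ℕ → EuclideanSpace ℝ (Fin n) → ℝ := fun k x => χ k x * (s k x * ‖G x‖ ^ 2) with hh
  have hh0 : ∀ k x, 0 ≤ h k x := fun k x =>
    mul_nonneg ((hχ k).2.2.2 x).1 (mul_nonneg (hs0 k x).le (sq_nonneg _))
  have hhc : ∀ k, ContinuousOn (h k) U := fun k =>
    (hχ k).1.continuous.continuousOn.mul
      ((hss k).continuousOn.mul (hGs.continuousOn.norm.pow 2))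
  have hhi : ∀ k, Integrable (h k) (volume.restrict U) := fun k => by
    have : Integrable (h k) := (((hhc k).mono (hχ k).2.2.1).integrableOn_compact
      (hχ k).2.1).integrable_of_forall_notMem_eq_zero fun x hx => by
        simp [hh, image_eq_zero_of_notMem_tsupport hx]
    exact this.integrableOn
  have hhM : ∀ k, ∫ x in U, h k x ≤ M := fun k => by
    refine le_trans (le_of_eq ?_) (hM (q k) (hqm k))
    rw [setIntegral_divergence_mul_eq hU (hf.of_le (by simp)) ((hqs k).of_le (by simp))
      (hqm k).2.1 (hqm k).2.2.1, ← integral_neg]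
    refine integral_congr_ae (Eventually.of_forall fun x => ?_)
    simp only [hq, hh]
    rw [inner_smul_right, inner_neg_right, inner_smul_right, real_inner_self_eq_norm_sq]
    ring
  have hlim : ∀ x ∈ U, Tendsto (fun k => ENNReal.ofReal (h k x)) atTop (𝓝 ‖G x‖ₑ) := by
    intro x hx
    rw [← ofReal_norm]
    refine (ENNReal.continuous_ofReal.tendsto _).comp ?_
    have h1 : Tendsto (fun k : ℕ => ‖G x‖ ^ 2 + (1 / ((k : ℝ) + 1)) ^ 2) atTop
        (𝓝 (‖G x‖ ^ 2)) := by
      simpa using (tendsto_one_div_add_atTop_nhds_zero_nat (𝕜 := ℝ)).pow 2 |>.const_add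
        (‖G x‖ ^ 2)
    have h2 : Tendsto (fun k => s k x * ‖G x‖ ^ 2) atTop (𝓝 ‖G x‖) := by
      rcases eq_or_ne (‖G x‖) 0 with h0 | h0
      · simp [h0]
      · have := ((Real.continuous_sqrt.tendsto _).comp h1).inv₀
          (by rw [Real.sqrt_sq (norm_nonneg _)]; exact h0)
        have := this.mul_const (‖G x‖ ^ 2)
        rw [Real.sqrt_sq (norm_nonneg _)] at this
        rwa [show ‖G x‖⁻¹ * ‖G x‖ ^ 2 = ‖G x‖ by field_simp] at this
    refine h2.congr' ?_
    filter_upwards [hχ1 x hx] with k hk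
    simp [hh, hk]
  calc ∫⁻ x in U, ‖G x‖ₑ = ∫⁻ x in U, liminf (fun k => ENNReal.ofReal (h k x)) atTop :=
        setLIntegral_congr_fun hU.measurableSet fun x hx => (hlim x hx).liminf_eq.symm
    _ ≤ liminf (fun k => ∫⁻ x in U, ENNReal.ofReal (h k x)) atTop :=
        lintegral_liminf_le' fun k => (hhi k).1.aemeasurable.ennreal_ofReal
    _ ≤ liminf (fun _ : ℕ => ENNReal.ofReal M) atTop := by
        refine liminf_le_liminf (Eventually.of_forall fun k => ?_)
        rw [← ofReal_integral_eq_lintegral_ofReal (hhi k) (Eventually.of_forall (hh0 k))]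
        exact ENNReal.ofReal_le_ofReal (hhM k)
    _ = ENNReal.ofReal M := by simp

end Divergence

section Limits

variable {E : Type*} [NormedAddCommGroup E] [InnerProductSpace ℝ E] [FiniteDimensional ℝ E]
  [MeasurableSpace E] [BorelSpace E] {F : Type*} [NormedAddCommGroup F] [NormedSpace ℝ F]

lemma tendsto_eLpNorm_variableMollify_sub [CompleteSpace F] {w : E → F}
    (hw : StronglyMeasurable w) {r : ENNReal} (h1 : 1 ≤ r) (hr : r ≠ ⊤) (hwr : MemLp w r volume)
    {δ : ℕ → E → ℝ} (hδ : ∀ k, LipschitzWith (1 / 2) (δ k)) {ε : ℕ → ℝ}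
    (hε : Tendsto ε atTop (𝓝 0)) (hδε : ∀ k x, |δ k x| ≤ ε k) :
    Tendsto (fun k => eLpNorm (variableMollify (δ k) w - w) r volume) atTop (𝓝 0) := by
  refine ENNReal.tendsto_nhds_zero.2 fun η hη => ?_
  obtain ⟨e, he, H⟩ := exists_eLpNorm_variableMollify_sub_le hw h1 hr hwr hη.ne'
  filter_upwards [hε.eventually_le_const he] with k hk
  exact H (δ k) (hδ k) fun x => (hδε k x).trans hk

lemma tendsto_integral_mul_of_tendsto_eLpNorm {ψ : E → ℝ} (hψ : Continuous ψ)
    (hψc : HasCompactSupport ψ) {r : ENNReal} [Fact (1 ≤ r)] {w : ℕ → E → ℝ} {w₀ : E → ℝ}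
    (hw : ∀ k, MemLp (w k) r volume) (hw₀ : MemLp w₀ r volume)
    (h : Tendsto (fun k => eLpNorm (w k - w₀) r volume) atTop (𝓝 0)) :
    Tendsto (fun k => ∫ x, ψ x * w k x) atTop (𝓝 (∫ x, ψ x * w₀ x)) := by
  have hψp : MemLp ψ (ENNReal.conjExponent r) volume := hψ.memLp_of_hasCompactSupport hψc
  have : (ENNReal.conjExponent r).HolderConjugate r :=
    (inferInstance : r.HolderConjugate (ENNReal.conjExponent r)).symm
  have hint : ∀ {f : E → ℝ}, MemLp f r volume → Integrable fun x => ψ x * f x := fun hf =>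
    memLp_one_iff_integrable.1 (MemLp.smul (r := 1) hf hψp)
  refine tendsto_integral_of_L1' _ (hint hw₀).1 (Eventually.of_forall fun k => hint (hw k)) ?_
  have hlim : Tendsto (fun k => eLpNorm ψ (ENNReal.conjExponent r) volume *
      eLpNorm (w k - w₀) r volume) atTop (𝓝 0) := by
    simpa using ENNReal.Tendsto.const_mul h (Or.inr hψp.2.ne)
  refine tendsto_of_tendsto_of_tendsto_of_le_of_le tendsto_const_nhds hlim (fun _ => zero_le) ?_
  intro k
  have heq : ((fun x => ψ x * w k x) - fun x => ψ x * w₀ x) = ψ • (w k - w₀) := by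
    ext x
    simp [mul_sub]
  simp only [heq]
  exact eLpNorm_smul_le_mul_eLpNorm (r := 1) ((hw k).1.sub hw₀.1) hψ.aestronglyMeasurable

lemma integral_mollifier_comp_neg (f : E → F) :
    ∫ y, f (-y) ∂mollifier E = ∫ y, f y ∂mollifier E := by
  rw [integral_mollifier, integral_mollifier, ← integral_neg_eq_self]
  simp [ContDiffBump.normed_neg]

lemma integrable_prod_comp_sub_smul {ψ : E → ℝ} (hψ : Integrable ψ) (hm : StronglyMeasurable ψ)
    (t : ℝ) :
    Integrable (fun z : E × E => ψ (z.1 - t • z.2)) ((volume : Measure E).prod (mollifier E)) := by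
  have hsm : StronglyMeasurable fun z : E × E => ψ (z.1 - t • z.2) :=
    hm.comp_measurable (by fun_prop : Continuous fun z : E × E => z.1 - t • z.2).measurable
  refine (integrable_prod_iff' hsm.aestronglyMeasurable).2
    ⟨Eventually.of_forall fun y => hψ.comp_sub_right (t • y), ?_⟩
  have : (fun y : E => ∫ x, ‖ψ (x - t • y)‖) = fun _ => ∫ x, ‖ψ x‖ := by
    ext y
    exact integral_sub_right_eq_self (fun x => ‖ψ x‖) (t • y)
  simp only [this]
  exact integrable_const _

/-- Mollification at a constant scale is symmetric. -/
lemma integral_mul_variableMollify_const {ψ φ : E → ℝ} (hψ : Continuous ψ)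
    (hψc : HasCompactSupport ψ) (hφm : StronglyMeasurable φ) (hφ : LocallyIntegrable φ) (t : ℝ) :
    ∫ x, ψ x * variableMollify (fun _ => t) φ x = ∫ x, variableMollify (fun _ => t) ψ x * φ x := by
  obtain ⟨C, hC⟩ := hψc.exists_bound_of_continuous hψ
  set B := cthickening |t| (tsupport ψ) with hB
  have hBc : IsCompact B := hψc.isCompact.cthickening
  have hBm : MeasurableSet B := isClosed_cthickening.measurableSet
  have hφB : Integrable (B.indicator φ) :=
    (hφ.integrableOn_isCompact hBc).integrable_indicator hBm
  have hae : ∀ᵐ z : E × E ∂((volume : Measure E).prod (mollifier E)), ‖z.2‖ ≤ 1 :=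
    Measure.quasiMeasurePreserving_snd.ae ae_mollifier_norm_le
  have hprod : Integrable (Function.uncurry fun x y => ψ x * φ (x - t • y))
      ((volume : Measure E).prod (mollifier E)) := by
    refine ((integrable_prod_comp_sub_smul hφB (hφm.indicator hBm) t).const_mul C).mono ?_ ?_
    · exact ((hψ.comp continuous_fst).stronglyMeasurable.mul (hφm.comp_measurable
        (by fun_prop : Continuous fun z : E × E => z.1 - t • z.2).measurable)).aestronglyMeasurable
    · filter_upwards [hae] with z hz
      by_cases hx : z.1 ∈ tsupport ψ
      · have hmem : z.1 - t • z.2 ∈ B := by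
          refine mem_cthickening_of_dist_le _ z.1 _ _ hx ?_
          simp only [dist_eq_norm, sub_sub_cancel_left, norm_neg, norm_smul, Real.norm_eq_abs]
          exact mul_le_of_le_one_right (abs_nonneg t) hz
        simp only [Function.uncurry, indicator_of_mem hmem, norm_mul]
        gcongr
        exact (hC _).trans (le_abs_self C)
      · simp only [Function.uncurry, image_eq_zero_of_notMem_tsupport hx, zero_mul, norm_zero]
        positivity
  calc ∫ x, ψ x * variableMollify (fun _ => t) φ x
      = ∫ x, ∫ y, ψ x * φ (x - t • y) ∂mollifier E := by
        simp only [variableMollify, integral_const_mul]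
    _ = ∫ y, (∫ x, ψ x * φ (x - t • y)) ∂mollifier E := integral_integral_swap hprod
    _ = ∫ y, (∫ x, ψ (x + t • y) * φ x) ∂mollifier E := by
        congr 1
        ext y
        rw [← integral_sub_right_eq_self (fun x => ψ (x + t • y) * φ x) (t • y)]
        simp
    _ = ∫ y, (∫ x, ψ (x - t • y) * φ x) ∂mollifier E := by
        rw [← integral_mollifier_comp_neg]
        simp [sub_eq_add_neg]
    _ = ∫ x, ∫ y, ψ (x - t • y) * φ x ∂mollifier E := by
        refine (integral_integral_swap ?_).symm
        refine ((hφB.comp_fst (mollifier E)).const_mul C).mono ?_ ?_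
        · exact ((hψ.comp (by fun_prop : Continuous fun z : E × E => z.1 - t • z.2)
            ).stronglyMeasurable.mul (hφm.comp_measurable measurable_fst)).aestronglyMeasurable
        · filter_upwards [hae] with z hz
          by_cases hx : z.1 - t • z.2 ∈ tsupport ψ
          · have hmem : z.1 ∈ B := by
              refine mem_cthickening_of_dist_le _ _ _ _ hx ?_
              simp only [dist_eq_norm, sub_sub_cancel, norm_smul, Real.norm_eq_abs]
              exact mul_le_of_le_one_right (abs_nonneg t) hz
            simp only [Function.uncurry, indicator_of_mem hmem, norm_mul]
            gcongr
            exact (hC _).trans (le_abs_self C)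
          · simp only [Function.uncurry, image_eq_zero_of_notMem_tsupport hx, zero_mul, norm_zero]
            positivity
    _ = _ := by simp only [variableMollify, integral_mul_const]

lemma contDiff_variableMollify_const [CompleteSpace F] {t : ℝ} (ht : 0 < t) (ht1 : t < 1)
    {w : E → F} (hw : LocallyIntegrable w) : ContDiff ℝ ∞ (variableMollify (fun _ => t) w) :=
  contDiffOn_univ.1 (contDiffOn_variableMollify contDiff_const (fun _ _ => ⟨ht, ht1⟩) hw)

lemma tsupport_variableMollify_const_subset (t : ℝ) (w : E → F) :
    tsupport (variableMollify (fun _ => t) w) ⊆ cthickening |t| (tsupport w) := by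
  refine closure_minimal (fun x hx => ?_) isClosed_cthickening
  by_contra h
  refine hx ?_
  refine integral_eq_zero_of_ae ?_
  filter_upwards [ae_mollifier_norm_le] with y hy
  refine image_eq_zero_of_notMem_tsupport fun hmem => h ?_
  refine mem_cthickening_of_dist_le _ _ _ _ hmem ?_
  simp only [dist_eq_norm, sub_sub_cancel, norm_smul, Real.norm_eq_abs]
  exact mul_le_of_le_one_right (abs_nonneg t) hy

lemma norm_variableMollify_le {δ : E → ℝ} {w : E → F} {C : ℝ} (hw : ∀ x, ‖w x‖ ≤ C) (x : E) :
    ‖variableMollify δ w x‖ ≤ C := by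
  have := norm_integral_le_of_norm_le_const (μ := mollifier E)
    (Eventually.of_forall fun y => hw (x - δ x • y))
  rwa [probReal_univ, mul_one] at this

end Limits

section TotalVariationEstimate

variable {n : ℕ}

lemma divergence_variableMollify_const {q : EuclideanSpace ℝ (Fin n) → EuclideanSpace ℝ (Fin n)}
    (hq : ContDiff ℝ 1 q) (t : ℝ) (x : EuclideanSpace ℝ (Fin n)) :
    divergence (variableMollify (fun _ => t) q) x =
      variableMollify (fun _ => t) (divergence q) x := by
  have hder := hasFDerivAt_variableMollify isOpen_univ (contDiff_const (c := t))
    (fun _ _ _ _ => mem_univ _) hq.continuous.stronglyMeasurable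
    hq.continuous.locallyIntegrable hq.contDiffOn (mem_univ x)
  have hstep : ∀ y, stepFDeriv (fun _ => t) q x y = fderiv ℝ q (x - t • y) := fun y => by
    simp [stepFDeriv]
  simp only [hstep] at hder
  have hcont : Continuous fun y => fderiv ℝ q (x - t • y) :=
    (hq.continuous_fderiv one_ne_zero).comp (by fun_prop)
  have hi : Integrable (fun y => fderiv ℝ q (x - t • y)) (mollifier _) :=
    integrable_mollifier_of_continuousOn hcont.continuousOn
  have hcoord : ∀ i : Fin n, (fderiv ℝ (variableMollify (fun _ => t) q) x
      (EuclideanSpace.single i 1)) i =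
      ∫ y, (fderiv ℝ q (x - t • y) (EuclideanSpace.single i 1)) i
        ∂mollifier (EuclideanSpace ℝ (Fin n)) := fun i => by
    rw [hder.fderiv, ContinuousLinearMap.integral_apply hi]
    exact ((EuclideanSpace.proj i : EuclideanSpace ℝ (Fin n) →L[ℝ] ℝ).integral_comp_comm
      (hi.apply_continuousLinearMap _)).symm
  simp only [divergence, variableMollify, hcoord]
  rw [integral_finsetSum]
  intro i _
  exact (EuclideanSpace.proj i : EuclideanSpace ℝ (Fin n) →L[ℝ] ℝ).integrable_comp
    (hi.apply_continuousLinearMap _)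

/-- Mollification at a constant scale does not increase the total variation. -/
lemma integral_divergence_mul_variableMollify_const_le {Ω U : Set (EuclideanSpace ℝ (Fin n))}
    {φ : EuclideanSpace ℝ (Fin n) → ℝ} (hφm : StronglyMeasurable φ) (hφ : LocallyIntegrable φ)
    {M : ℝ} (hM : ∀ q ∈ testFields Ω, ∫ x in Ω, divergence q x * φ x ≤ M) {t : ℝ} (ht : 0 < t)
    (ht1 : t < 1) (hU : cthickening t U ⊆ Ω)
    {q : EuclideanSpace ℝ (Fin n) → EuclideanSpace ℝ (Fin n)} (hq : q ∈ testFields U) :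
    ∫ x in U, divergence q x * variableMollify (fun _ => t) φ x ≤ M := by
  obtain ⟨hqs, hqc, hqU, hq1⟩ := hq
  have hq1' : ContDiff ℝ 1 q := hqs.of_le (by simp)
  have hts := tsupport_variableMollify_const_subset t q
  rw [abs_of_pos ht] at hts
  have hmem : variableMollify (fun _ => t) q ∈ testFields Ω :=
    ⟨contDiff_variableMollify_const ht ht1 hqs.continuous.locallyIntegrable,
      hqc.isCompact.cthickening.of_isClosed_subset (isClosed_tsupport _) hts,
      hts.trans ((cthickening_subset_of_subset t hqU).trans hU),
      norm_variableMollify_le hq1⟩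
  have := hM _ hmem
  rw [setIntegral_divergence_mul hmem.2.2.1] at this
  rw [setIntegral_divergence_mul hqU, integral_mul_variableMollify_const
    (continuous_divergence hq1') (hasCompactSupport_divergence hqc) hφm hφ]
  simpa only [divergence_variableMollify_const hq1'] using this

/-- The total variation of the mollification of a function, whose smoothing at constant scale is
under control, is under control. -/
lemma integral_divergence_mul_variableMollify_le_of_lintegral
    {Ω U : Set (EuclideanSpace ℝ (Fin n))} (hΩ : IsOpen Ω) (hU : IsOpen U)
    {δ : EuclideanSpace ℝ (Fin n) → ℝ} {c : ℝ≥0} (hδ : ContDiff ℝ ∞ δ) (hL : LipschitzWith c δ)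
    (hc : c < 1) (hpos : ∀ x ∈ Ω, 0 < δ x ∧ δ x < 1)
    {f : EuclideanSpace ℝ (Fin n) → ℝ} (hf : ContDiff ℝ ∞ f)
    {M : ℝ} (hM0 : 0 ≤ M) (hM : ∫⁻ x in U, ‖gradient f x‖ₑ ≤ ENNReal.ofReal M)
    {q : EuclideanSpace ℝ (Fin n) → EuclideanSpace ℝ (Fin n)} (hq : q ∈ testFields Ω)
    (hqU : ∀ x ∈ tsupport q, ∀ y : EuclideanSpace ℝ (Fin n), ‖y‖ ≤ 1 → x - δ x • y ∈ U) :
    ∫ x in Ω, divergence q x * variableMollify δ f x ≤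
      (1 + c) * (((1 - c)⁻¹ : ℝ≥0) ^ n * M) := by
  obtain ⟨hqs, hqc, hqΩ, hq1⟩ := hq
  have hGc : Continuous (gradient f) :=
    continuousOn_univ.1 (contDiffOn_gradient isOpen_univ hf.contDiffOn).continuousOn
  set w : EuclideanSpace ℝ (Fin n) → ℝ := U.indicator fun x => ‖gradient f x‖ with hw
  have hwm : StronglyMeasurable w := hGc.norm.stronglyMeasurable.indicator hU.measurableSet
  have hw0 : ∀ x, 0 ≤ w x := fun x => indicator_nonneg (fun _ _ => norm_nonneg _) x
  have hwn : eLpNorm w 1 volume ≤ ENNReal.ofReal M := by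
    rw [hw, eLpNorm_indicator_eq_eLpNorm_restrict hU.measurableSet,
      eLpNorm_one_eq_lintegral_enorm]
    simpa using hM
  have hw1 : MemLp w 1 volume :=
    ⟨hwm.aestronglyMeasurable, hwn.trans_lt ENNReal.ofReal_lt_top⟩
  have hW0 : ∀ x, 0 ≤ variableMollify δ w x := fun x => integral_nonneg fun _ => hw0 _
  have hWi : Integrable (variableMollify δ w) := memLp_one_iff_integrable.1
    (memLp_variableMollify hL hc hwm le_rfl ENNReal.one_ne_top hw1)
  have hWle : ∫ x in Ω, variableMollify δ w x ≤ ((1 - c)⁻¹ : ℝ≥0) ^ n * M := by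
    refine (setIntegral_le_integral hWi (Eventually.of_forall hW0)).trans ?_
    have h1 := (eLpNorm_variableMollify_le hL hc hwm le_rfl ENNReal.one_ne_top).trans
      (mul_le_mul_right hwn _)
    rw [eLpNorm_one_eq_lintegral_enorm] at h1
    have h2 : ENNReal.ofReal (∫ x, variableMollify δ w x) =
        ∫⁻ x, ‖variableMollify δ w x‖ₑ := by
      rw [ofReal_integral_eq_lintegral_ofReal hWi (Eventually.of_forall hW0)]
      exact lintegral_congr fun x => (Real.enorm_of_nonneg (hW0 x)).symm
    rw [← h2] at h1
    refine (ENNReal.ofReal_le_ofReal_iff (by positivity)).1 (h1.trans (le_of_eq ?_))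
    simp only [ENNReal.toReal_one, ENNReal.rpow_one, finrank_euclideanSpace, Fintype.card_fin, div_one]
    rw [ENNReal.ofReal_mul (by positivity), ENNReal.ofReal_pow (NNReal.coe_nonneg _),
      ENNReal.ofReal_coe_nnreal]
  have hS : ContDiffOn ℝ 1 (variableMollify δ f) Ω :=
    (contDiffOn_variableMollify hδ hpos hf.continuous.locallyIntegrable).of_le (by simp)
  rw [setIntegral_divergence_mul_eq hΩ hS (hqs.of_le (by simp)) hqc hqΩ, ← integral_neg]
  have hpt : ∀ x ∈ tsupport q, ‖gradient (variableMollify δ f) x‖ ≤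
      (1 + c) * variableMollify δ w x := by
    intro x hx
    have h1 := norm_gradient_variableMollify_sub_le isOpen_univ (hδ.of_le (by simp)) hL
      (fun _ _ _ _ => mem_univ _) hf.continuous.stronglyMeasurable
      hf.continuous.locallyIntegrable (hf.of_le (by simp)).contDiffOn (mem_univ x)
    have h2 : ‖variableMollify δ (gradient f) x‖ ≤
        variableMollify δ (fun z => ‖gradient f z‖) x := norm_integral_le_integral_norm _
    have h3 : variableMollify δ (fun z => ‖gradient f z‖) x = variableMollify δ w x := by
      refine integral_congr_ae ?_
      filter_upwards [ae_mollifier_norm_le] with y hy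
      rw [hw, indicator_of_mem (hqU x hx y hy)]
    rw [h3] at h1 h2
    calc ‖gradient (variableMollify δ f) x‖
        ≤ ‖gradient (variableMollify δ f) x - variableMollify δ (gradient f) x‖ +
          ‖variableMollify δ (gradient f) x‖ := by
          simpa using norm_add_le (gradient (variableMollify δ f) x -
            variableMollify δ (gradient f) x) (variableMollify δ (gradient f) x)
      _ ≤ _ := by linarith
  calc ∫ x in Ω, -inner ℝ (gradient (variableMollify δ f) x) (q x)
      ≤ ∫ x in Ω, (1 + c) * variableMollify δ w x := by
        refine (Real.le_norm_self _).trans (norm_integral_le_of_norm_le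
          (hWi.integrableOn.const_mul _) (Eventually.of_forall fun x => ?_))
        rw [norm_neg]
        by_cases hx : x ∈ tsupport q
        · refine (norm_inner_le_norm _ _).trans ?_
          exact (mul_le_of_le_one_right (norm_nonneg _) (hq1 x)).trans (hpt x hx)
        · rw [image_eq_zero_of_notMem_tsupport hx, inner_zero_right, norm_zero]
          exact mul_nonneg (by positivity) (hW0 x)
    _ ≤ _ := by
        rw [integral_const_mul]
        gcongr

/-- Mollification at a variable scale with small Lipschitz constant almost decreases the total
variation. -/
lemma integral_divergence_mul_variableMollify_le
    {Ω : Set (EuclideanSpace ℝ (Fin n))} (hΩ : IsOpen Ω)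
    {δ : EuclideanSpace ℝ (Fin n) → ℝ} {c : ℝ≥0} (hδ : ContDiff ℝ ∞ δ) (hL : LipschitzWith c δ)
    (hc : c < 1) (hpos : ∀ x ∈ Ω, 0 < δ x ∧ δ x < 1) (h0 : ∀ x ∉ Ω, δ x = 0)
    {r : ENNReal} [Fact (1 ≤ r)] (hr : r ≠ ⊤)
    {φ : EuclideanSpace ℝ (Fin n) → ℝ} (hφm : StronglyMeasurable φ) (hφ : MemLp φ r volume)
    {M : ℝ} (hM0 : 0 ≤ M) (hM : ∀ q ∈ testFields Ω, ∫ x in Ω, divergence q x * φ x ≤ M)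
    {q : EuclideanSpace ℝ (Fin n) → EuclideanSpace ℝ (Fin n)} (hq : q ∈ testFields Ω) :
    ∫ x in Ω, divergence q x * variableMollify δ φ x ≤
      (1 + c) * (((1 - c)⁻¹ : ℝ≥0) ^ n * M) := by
  have h1r : 1 ≤ r := Fact.out
  have hφl : LocallyIntegrable φ := hφ.locallyIntegrable h1r
  have hδc : Continuous δ := hδ.continuous
  set K := (fun z : EuclideanSpace ℝ (Fin n) × EuclideanSpace ℝ (Fin n) =>
    z.1 - δ z.1 • z.2) '' (tsupport q ×ˢ closedBall 0 1) with hK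
  have hKc : IsCompact K := (hq.2.1.isCompact.prod (isCompact_closedBall _ _)).image (by fun_prop)
  have hKΩ : K ⊆ Ω := by
    rintro _ ⟨⟨x, y⟩, ⟨hx, hy⟩, rfl⟩
    exact (sub_smul_mem_iff hL hc (by simpa using hy) h0).2 (hq.2.2.1 hx)
  obtain ⟨η, hη, hηΩ⟩ := hKc.exists_cthickening_subset_open hΩ hKΩ
  have hKU : ∀ x ∈ tsupport q, ∀ y : EuclideanSpace ℝ (Fin n), ‖y‖ ≤ 1 →
      x - δ x • y ∈ thickening (η / 2) K := fun x hx y hy =>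
    self_subset_thickening (by positivity) _ ⟨(x, y), ⟨hx, by simpa using hy⟩, rfl⟩
  set t : ℕ → ℝ := fun k => 1 / ((k : ℝ) + 1) / 2 with ht
  have ht0 : ∀ k, 0 < t k := fun k => by positivity
  have ht1 : ∀ k, t k < 1 := fun k => by
    have : 1 / ((k : ℝ) + 1) ≤ 1 := by
      rw [div_le_one (by positivity)]
      linarith [(Nat.cast_nonneg k : (0 : ℝ) ≤ k)]
    simp only [ht]
    linarith
  have htlim : Tendsto t atTop (𝓝 0) := by
    have := (tendsto_one_div_add_atTop_nhds_zero_nat (𝕜 := ℝ)).div_const 2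
    rwa [zero_div] at this
  set f : ℕ → EuclideanSpace ℝ (Fin n) → ℝ := fun k => variableMollify (fun _ => t k) φ with hf
  have hconst : ∀ (s : ℝ) (C : ℝ≥0), LipschitzWith C
      (fun _ : EuclideanSpace ℝ (Fin n) => s) := fun s C => LipschitzWith.const' s
  have hfm : ∀ k, StronglyMeasurable (f k) := fun k =>
    stronglyMeasurable_variableMollify continuous_const hφm
  have hfp : ∀ k, MemLp (f k) r volume := fun k =>
    memLp_variableMollify (hconst _ 0) zero_lt_one hφm h1r hr hφ
  have hflim : Tendsto (fun k => eLpNorm (f k - φ) r volume) atTop (𝓝 0) :=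
    tendsto_eLpNorm_variableMollify_sub hφm h1r hr hφ (fun k => hconst _ _) htlim
      fun k _ => (abs_of_pos (ht0 k)).le
  have hSsub : ∀ k, variableMollify δ (f k) - variableMollify δ φ =
      variableMollify δ (f k - φ) := fun k => by
    ext x
    exact (integral_sub (integrable_mollifier_comp ((hfp k).locallyIntegrable h1r) x (δ x))
      (integrable_mollifier_comp hφl x (δ x))).symm
  have hSlim : Tendsto (fun k => eLpNorm (variableMollify δ (f k) - variableMollify δ φ) r volume)
      atTop (𝓝 0) := by
    set C : ENNReal := ((((1 - c)⁻¹ : ℝ≥0) : ENNReal) ^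
      Module.finrank ℝ (EuclideanSpace ℝ (Fin n))) ^ (1 / r).toReal with hC
    have hCt : C ≠ ⊤ := ENNReal.rpow_ne_top_of_nonneg ENNReal.toReal_nonneg
      (ENNReal.pow_ne_top ENNReal.coe_ne_top)
    have hlim : Tendsto (fun k => C * eLpNorm (f k - φ) r volume) atTop (𝓝 0) := by
      simpa using ENNReal.Tendsto.const_mul hflim (Or.inr hCt)
    refine tendsto_of_tendsto_of_tendsto_of_le_of_le tendsto_const_nhds hlim
      (fun _ => zero_le) fun k => ?_
    simp only [hSsub]
    exact eLpNorm_variableMollify_le hL hc ((hfm k).sub hφm) h1r hr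
  have hlim := tendsto_integral_mul_of_tendsto_eLpNorm
    (continuous_divergence (hq.1.of_le (by simp))) (hasCompactSupport_divergence hq.2.1)
    (fun k => memLp_variableMollify hL hc (hfm k) h1r hr (hfp k))
    (memLp_variableMollify hL hc hφm h1r hr hφ) hSlim
  simp only [← setIntegral_divergence_mul hq.2.2.1] at hlim
  refine le_of_tendsto hlim ?_
  filter_upwards [htlim.eventually_le_const (by positivity : 0 < η / 2)] with k hk
  refine integral_divergence_mul_variableMollify_le_of_lintegral hΩ isOpen_thickening hδ hL hc hpos
    (contDiff_variableMollify_const (ht0 k) (ht1 k) hφl) hM0 ?_ hq hKU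
  refine lintegral_gradient_le isOpen_thickening
    (contDiff_variableMollify_const (ht0 k) (ht1 k) hφl).contDiffOn fun q' hq' => ?_
  refine integral_divergence_mul_variableMollify_const_le hφm hφl hM (ht0 k) (ht1 k) ?_ hq'
  refine (cthickening_thickening_subset (ht0 k).le _ _).trans
    ((cthickening_mono (by linarith) _).trans hηΩ)

end TotalVariationEstimate

section Scales

variable {n : ℕ}

/-- Scales `δ` which are adapted to an open set `Ω`: they vanish exactly outside of `Ω`. -/
structure IsScale (Ω : Set (EuclideanSpace ℝ (Fin n))) (c : ℝ≥0)
    (δ : EuclideanSpace ℝ (Fin n) → ℝ) : Prop where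
  contDiff : ContDiff ℝ ∞ δ
  lipschitz : LipschitzWith c δ
  le_half : c ≤ 1 / 2
  pos : ∀ x ∈ Ω, 0 < δ x ∧ δ x < 1
  eq_zero : ∀ x ∉ Ω, δ x = 0
  abs_le : ∀ x, |δ x| ≤ c

lemma IsScale.lt_one {Ω : Set (EuclideanSpace ℝ (Fin n))} {c : ℝ≥0}
    {δ : EuclideanSpace ℝ (Fin n) → ℝ} (h : IsScale Ω c δ) : c < 1 :=
  h.le_half.trans_lt (by rw [div_lt_one] <;> norm_num)

lemma IsScale.mem {Ω : Set (EuclideanSpace ℝ (Fin n))} {c : ℝ≥0}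
    {δ : EuclideanSpace ℝ (Fin n) → ℝ} (h : IsScale Ω c δ) :
    ∀ x ∈ Ω, ∀ y : EuclideanSpace ℝ (Fin n), ‖y‖ ≤ 1 → x - δ x • y ∈ Ω :=
  fun _ hx _ hy => (sub_smul_mem_iff h.lipschitz h.lt_one hy h.eq_zero).2 hx

lemma exists_isScale {Ω : Set (EuclideanSpace ℝ (Fin n))} (hΩ : IsOpen Ω) :
    ∃ (c : ℕ → ℝ≥0) (δ : ℕ → EuclideanSpace ℝ (Fin n) → ℝ), (∀ k, IsScale Ω (c k) (δ k)) ∧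
      Tendsto c atTop (𝓝 0) := by
  obtain ⟨d, hd, hL, hs, h01⟩ := exists_contDiff_lipschitz_support_eq hΩ
  set c : ℕ → ℝ≥0 := fun k => 1 / 2 * (1 / ((k : ℝ≥0) + 1)) with hc
  have hc0 : ∀ k, 0 < c k := fun k => by positivity
  have hc1 : ∀ k, c k ≤ 1 / 2 := fun k => by
    refine mul_le_of_le_one_right' ?_
    rw [div_le_one (by positivity)]
    exact le_add_of_nonneg_left zero_le
  refine ⟨c, fun k x => c k * d x, fun k => ⟨contDiff_const.mul hd, ?_, hc1 k, fun x hx => ?_,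
    fun x hx => ?_, fun x => ?_⟩, ?_⟩
  · refine LipschitzWith.of_dist_le_mul fun x y => ?_
    rw [Real.dist_eq, ← mul_sub, abs_mul, abs_of_nonneg (c k).coe_nonneg]
    gcongr
    simpa [Real.dist_eq] using hL.dist_le_mul x y
  · have hne : d x ≠ 0 := by
      rw [← hs] at hx
      exact hx
    have h1 : (c k : ℝ) ≤ 1 / 2 := by exact_mod_cast hc1 k
    have h2 : (0 : ℝ) < c k := NNReal.coe_pos.2 (hc0 k)
    have h3 := h01 x
    exact ⟨mul_pos h2 (lt_of_le_of_ne h3.1 hne.symm), by nlinarith⟩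
  · rw [← hs, Function.notMem_support] at hx
    simp [hx]
  · rw [abs_of_nonneg (mul_nonneg (c k).coe_nonneg (h01 x).1)]
    exact mul_le_of_le_one_right (c k).coe_nonneg (h01 x).2
  · have h1 : Tendsto (fun k : ℕ => (1 / ((k : ℝ≥0) + 1))) atTop (𝓝 0) :=
      tendsto_one_div_add_atTop_nhds_zero_nat
    have h2 := h1.const_mul (1 / 2)
    rwa [mul_zero] at h2

variable {Ω : Set (EuclideanSpace ℝ (Fin n))} {c : ℕ → ℝ≥0}
  {δ : ℕ → EuclideanSpace ℝ (Fin n) → ℝ}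

lemma tendsto_eLpNorm_variableMollify_sub_of_isScale {F : Type*} [NormedAddCommGroup F]
    [NormedSpace ℝ F] [CompleteSpace F] (hδ : ∀ k, IsScale Ω (c k) (δ k))
    (hc : Tendsto c atTop (𝓝 0)) {r : ENNReal} (h1 : 1 ≤ r) (hr : r ≠ ⊤)
    {w : EuclideanSpace ℝ (Fin n) → F} (hw : StronglyMeasurable w) (hwr : MemLp w r volume) :
    Tendsto (fun k => eLpNorm (variableMollify (δ k) w - w) r volume) atTop (𝓝 0) :=
  tendsto_eLpNorm_variableMollify_sub hw h1 hr hwr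
    (fun k => (hδ k).lipschitz.weaken (hδ k).le_half)
    (ε := fun k => (c k : ℝ)) (by simpa using NNReal.tendsto_coe.2 hc) fun k x => (hδ k).abs_le x

/-- Continuous functionals on `L^r(Ω)` are continuous along mollifications. -/
lemma tendsto_dual_variableMollify (hδ : ∀ k, IsScale Ω (c k) (δ k))
    (hc : Tendsto c atTop (𝓝 0)) {r : ENNReal} [Fact (1 ≤ r)] (hr : r ≠ ⊤)
    (p : StrongDual ℝ (Lp ℝ r (volume.restrict Ω)))
    {w : EuclideanSpace ℝ (Fin n) → ℝ} (hw : StronglyMeasurable w) (hwr : MemLp w r volume)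
    (hk : ∀ k, MemLp (variableMollify (δ k) w) r (volume.restrict Ω))
    (h : MemLp w r (volume.restrict Ω)) :
    Tendsto (fun k => p ((hk k).toLp _)) atTop (𝓝 (p (h.toLp w))) := by
  refine (p.continuous.tendsto _).comp ((Lp.tendsto_Lp_iff_tendsto_eLpNorm'' _ hk _ h).2 ?_)
  refine tendsto_of_tendsto_of_tendsto_of_le_of_le tendsto_const_nhds
    (tendsto_eLpNorm_variableMollify_sub_of_isScale hδ hc Fact.out hr hw hwr)
    (fun _ => zero_le) fun k => eLpNorm_mono_measure _ Measure.restrict_le_self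

lemma integral_norm_gradient_variableMollify_le (hΩ : IsOpen Ω) {c : ℝ≥0}
    {δ : EuclideanSpace ℝ (Fin n) → ℝ} (hδ : IsScale Ω c δ) {r : ENNReal} [Fact (1 ≤ r)]
    (hr : r ≠ ⊤) {φ : EuclideanSpace ℝ (Fin n) → ℝ} (hφm : StronglyMeasurable φ)
    (hφ : MemLp φ r volume) {M : ℝ} (hM0 : 0 ≤ M)
    (hM : ∀ q ∈ testFields Ω, ∫ x in Ω, divergence q x * φ x ≤ M) :
    Integrable (gradient (variableMollify δ φ)) (volume.restrict Ω) ∧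
      ∫ x in Ω, ‖gradient (variableMollify δ φ) x‖ ≤
        (1 + c) * (((1 - c)⁻¹ : ℝ≥0) ^ n * M) := by
  have hs : ContDiffOn ℝ ∞ (variableMollify δ φ) Ω :=
    contDiffOn_variableMollify hδ.contDiff hδ.pos (hφ.locallyIntegrable Fact.out)
  have hle := lintegral_gradient_le hΩ hs fun q hq =>
    integral_divergence_mul_variableMollify_le hΩ hδ.contDiff hδ.lipschitz hδ.lt_one hδ.pos
      hδ.eq_zero hr hφm hφ hM0 hM hq
  have hi : Integrable (gradient (variableMollify δ φ)) (volume.restrict Ω) :=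
    ⟨(contDiffOn_gradient hΩ hs).continuousOn.aestronglyMeasurable hΩ.measurableSet,
      hle.trans_lt ENNReal.ofReal_lt_top⟩
  refine ⟨hi, ?_⟩
  rw [integral_norm_eq_lintegral_enorm hi.1]
  exact ENNReal.toReal_le_of_le_ofReal (by positivity) hle

/-- The gradients of the mollifications of a function in `C^1(Ω)` with integrable gradient
converge in `L^1(Ω)`. -/
lemma tendsto_gradient_variableMollify (hΩ : IsOpen Ω) (hδ : ∀ k, IsScale Ω (c k) (δ k))
    (hc : Tendsto c atTop (𝓝 0)) {w : EuclideanSpace ℝ (Fin n) → ℝ} (hwm : StronglyMeasurable w)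
    (hwl : LocallyIntegrable w) (hw : ContDiffOn ℝ 1 w Ω)
    (hg : Integrable (gradient w) (volume.restrict Ω)) :
    (∀ k, Integrable (gradient (variableMollify (δ k) w)) (volume.restrict Ω)) ∧
      Tendsto (fun k => eLpNorm (gradient (variableMollify (δ k) w) - gradient w) 1
        (volume.restrict Ω)) atTop (𝓝 0) := by
  set G := Ω.indicator (gradient w) with hG
  have hgm : StronglyMeasurable (gradient w) :=
    ((InnerProductSpace.toDual ℝ _).symm.continuous.measurable.comp
      (measurable_fderiv ℝ w)).stronglyMeasurable
  have hGm : StronglyMeasurable G := hgm.indicator hΩ.measurableSet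
  have hG1 : MemLp G 1 volume :=
    (memLp_indicator_iff_restrict hΩ.measurableSet).2 (memLp_one_iff_integrable.2 hg)
  have hpt : ∀ k, ∀ᵐ x ∂(volume.restrict Ω),
      ‖(gradient (variableMollify (δ k) w) - gradient w) x‖ ≤
        ‖‖(variableMollify (δ k) G - G) x‖ + c k * variableMollify (δ k) (fun z => ‖G z‖) x‖ := by
    intro k
    refine (ae_restrict_iff' hΩ.measurableSet).2 (Eventually.of_forall fun x hx => ?_)
    have h1 := norm_gradient_variableMollify_sub_le hΩ ((hδ k).contDiff.of_le (by simp))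
      (hδ k).lipschitz (hδ k).mem hwm hwl hw hx
    have hcongr : ∀ᵐ y ∂mollifier (EuclideanSpace ℝ (Fin n)),
        gradient w (x - δ k x • y) = G (x - δ k x • y) := by
      filter_upwards [ae_mollifier_norm_le] with y hy
      rw [hG, indicator_of_mem ((hδ k).mem x hx y hy)]
    have h2 : variableMollify (δ k) (gradient w) x = variableMollify (δ k) G x :=
      integral_congr_ae hcongr
    have h3 : variableMollify (δ k) (fun z => ‖gradient w z‖) x =
        variableMollify (δ k) (fun z => ‖G z‖) x :=
      integral_congr_ae (hcongr.mono fun y hy => by simp only [hy])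
    have h4 : gradient w x = G x := by rw [hG, indicator_of_mem hx]
    rw [h2, h3] at h1
    refine le_trans ?_ (le_abs_self _)
    simp only [Pi.sub_apply, h4]
    calc _ = ‖(gradient (variableMollify (δ k) w) x - variableMollify (δ k) G x) +
          (variableMollify (δ k) G x - G x)‖ := by simp
      _ ≤ _ := (norm_add_le _ _).trans (by linarith)
  have hhalf : (1 / 2 : ℝ≥0) < 1 := by rw [div_lt_one] <;> norm_num
  have hL : ∀ k, LipschitzWith (1 / 2) (δ k) := fun k => (hδ k).lipschitz.weaken (hδ k).le_half
  set C : ENNReal := ((((1 - 1 / 2)⁻¹ : ℝ≥0) : ENNReal) ^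
    Module.finrank ℝ (EuclideanSpace ℝ (Fin n))) ^ (1 / (1 : ENNReal)).toReal *
      eLpNorm (fun z => ‖G z‖) 1 volume with hC
  have hCt : C ≠ ⊤ := ENNReal.mul_ne_top (ENNReal.rpow_ne_top_of_nonneg ENNReal.toReal_nonneg
      (ENNReal.pow_ne_top ENNReal.coe_ne_top)) hG1.norm.2.ne
  have hbound : ∀ k, eLpNorm (gradient (variableMollify (δ k) w) - gradient w) 1
      (volume.restrict Ω) ≤ eLpNorm (variableMollify (δ k) G - G) 1 volume + c k * C := by
    intro k
    refine (eLpNorm_mono_ae (hpt k)).trans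
      ((eLpNorm_mono_measure _ Measure.restrict_le_self).trans ?_)
    have m1 : StronglyMeasurable (variableMollify (δ k) G - G) :=
      (stronglyMeasurable_variableMollify (hδ k).contDiff.continuous hGm).sub hGm
    have m2 : StronglyMeasurable (variableMollify (δ k) fun z => ‖G z‖) :=
      stronglyMeasurable_variableMollify (hδ k).contDiff.continuous hGm.norm
    refine (eLpNorm_add_le m1.norm.aestronglyMeasurable
      (m2.const_mul (c k : ℝ)).aestronglyMeasurable le_rfl).trans ?_
    refine add_le_add (eLpNorm_norm _).le ?_
    have h5 := eLpNorm_const_smul_le (c := (c k : ℝ))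
      (f := variableMollify (δ k) fun z => ‖G z‖) (p := 1) (μ := volume)
    refine h5.trans ?_
    have h6 : ‖(c k : ℝ)‖ₑ = c k := by
      rw [Real.enorm_of_nonneg (c k).coe_nonneg, ENNReal.ofReal_coe_nnreal]
    rw [h6]
    gcongr
    exact eLpNorm_variableMollify_le (hL k) hhalf hGm.norm le_rfl ENNReal.one_ne_top
  have hlim : Tendsto (fun k => eLpNorm (variableMollify (δ k) G - G) 1 volume + c k * C) atTop
      (𝓝 0) := by
    have h7 : Tendsto (fun k => (c k : ENNReal) * C) atTop (𝓝 0) := by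
      have := ENNReal.Tendsto.mul_const (b := C) (ENNReal.tendsto_coe.2 hc) (Or.inr hCt)
      simpa using this
    simpa using (tendsto_eLpNorm_variableMollify_sub_of_isScale hδ hc le_rfl ENNReal.one_ne_top
      hGm hG1).add h7
  refine ⟨fun k => ?_, tendsto_of_tendsto_of_tendsto_of_le_of_le tendsto_const_nhds hlim
    (fun _ => zero_le) hbound⟩
  have hs : ContDiffOn ℝ ∞ (variableMollify (δ k) w) Ω :=
    contDiffOn_variableMollify (hδ k).contDiff (hδ k).pos hwl
  have hm : AEStronglyMeasurable (gradient (variableMollify (δ k) w)) (volume.restrict Ω) :=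
    (contDiffOn_gradient hΩ hs).continuousOn.aestronglyMeasurable hΩ.measurableSet
  have hdiff : MemLp (gradient (variableMollify (δ k) w) - gradient w) 1 (volume.restrict Ω) := by
    refine ⟨hm.sub hg.1, (hbound k).trans_lt ?_⟩
    refine ENNReal.add_lt_top.2 ⟨?_, ENNReal.mul_lt_top ENNReal.coe_lt_top hCt.lt_top⟩
    exact ((memLp_variableMollify (hδ k).lipschitz (hδ k).lt_one hGm le_rfl
      ENNReal.one_ne_top hG1).sub hG1).2
  simpa using (memLp_one_iff_integrable.1 hdiff).add hg

end Scales

lemma infConv_le {E : Type*} [NormedAddCommGroup E] (F G : E → EReal) {v φ ψ : E}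
    (h : v = φ + ψ) : infConv F G v ≤ F φ + G ψ :=
  iInf_le_of_le φ (iInf_le_of_le ψ (iInf_le _ h))

section TotalVariationBasic

variable {n : ℕ} {Ω : Set (EuclideanSpace ℝ (Fin n))} {r : ENNReal}

lemma totalVariation_le_iff {w : Lp ℝ r (volume.restrict Ω)} {M : ℝ} :
    totalVariation Ω r w ≤ (M : EReal) ↔
      ∀ q ∈ testFields Ω, ∫ x in Ω, divergence q x * w x ≤ M := by
  simp only [totalVariation, iSup_le_iff, EReal.coe_le_coe_iff]

lemma zero_mem_testFields : (0 : EuclideanSpace ℝ (Fin n) → EuclideanSpace ℝ (Fin n)) ∈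
    testFields Ω :=
  ⟨contDiff_const, HasCompactSupport.zero, by simp [tsupport], by simp⟩

lemma totalVariation_nonneg (w : Lp ℝ r (volume.restrict Ω)) : 0 ≤ totalVariation Ω r w := by
  refine le_trans (le_of_eq ?_) (le_iSup₂_of_le 0 zero_mem_testFields le_rfl)
  simp [divergence]

lemma totalVariation_ne_bot (w : Lp ℝ r (volume.restrict Ω)) : totalVariation Ω r w ≠ ⊥ :=
  ((EReal.bot_lt_zero).trans_le (totalVariation_nonneg w)).ne'

lemma totalVariation_zero_le : totalVariation Ω r 0 ≤ ((0 : ℝ) : EReal) := by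
  refine totalVariation_le_iff.2 fun q _ => le_of_eq (integral_eq_zero_of_ae ?_)
  filter_upwards [Lp.coeFn_zero ℝ r (volume.restrict Ω)] with x hx
  rw [hx, Pi.zero_apply, mul_zero]

lemma totalVariation_smul_le {w : Lp ℝ r (volume.restrict Ω)} {M : ℝ}
    (h : totalVariation Ω r w ≤ (M : EReal)) {a : ℝ} (ha : 0 ≤ a) :
    totalVariation Ω r (a • w) ≤ ((a * M : ℝ) : EReal) := by
  refine totalVariation_le_iff.2 fun q hq => ?_
  have : ∫ x in Ω, divergence q x * (a • w) x = a * ∫ x in Ω, divergence q x * w x := by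
    rw [← integral_const_mul]
    refine integral_congr_ae ?_
    filter_upwards [Lp.coeFn_smul a w] with x hx
    rw [hx, Pi.smul_apply, smul_eq_mul]
    ring
  rw [this]
  exact mul_le_mul_of_nonneg_left (totalVariation_le_iff.1 h q hq) ha

lemma totalVariation_neg_le (w : Lp ℝ r (volume.restrict Ω)) :
    totalVariation Ω r (-w) ≤ totalVariation Ω r w := by
  refine iSup₂_le fun q hq => le_iSup₂_of_le (-q) ?_ (EReal.coe_le_coe_iff.2 (le_of_eq ?_))
  · have hts : tsupport (-q) = tsupport q := by simp [tsupport, Function.support_neg]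
    exact ⟨hq.1.neg, by rw [HasCompactSupport, hts]; exact hq.2.1, hts ▸ hq.2.2.1, fun x => by
      simpa using hq.2.2.2 x⟩
  · refine integral_congr_ae ?_
    filter_upwards [Lp.coeFn_neg w] with x hx
    have : divergence (-q) x = -divergence q x := by
      simp [divergence, fderiv_neg]
    rw [hx, this, Pi.neg_apply]
    ring

lemma totalVariation_neg (w : Lp ℝ r (volume.restrict Ω)) :
    totalVariation Ω r (-w) = totalVariation Ω r w :=
  le_antisymm (totalVariation_neg_le w) (by simpa using totalVariation_neg_le (-w))

/-- The total variation is one-homogeneous, hence equal to its subgradients at `u`. -/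
lemma totalVariation_eq_of_mem_subdifferential [Fact (1 ≤ r)] {u : Lp ℝ r (volume.restrict Ω)}
    {p : StrongDual ℝ (Lp ℝ r (volume.restrict Ω))}
    (hp : p ∈ subdifferential (totalVariation Ω r) u) :
    totalVariation Ω r u = ((p u : ℝ) : EReal) := by
  obtain ⟨ht, hb, hsub⟩ := hp
  set j := (totalVariation Ω r u).toReal with hj
  have hju : totalVariation Ω r u = (j : EReal) := (EReal.coe_toReal ht hb).symm
  have h0 := (hsub 0).trans totalVariation_zero_le
  have h2 := (hsub ((2 : ℝ) • u)).trans (totalVariation_smul_le hju.le zero_le_two)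
  rw [hju, ← EReal.coe_add, EReal.coe_le_coe_iff] at h0 h2
  rw [zero_sub, map_neg] at h0
  rw [two_smul, add_sub_cancel_right] at h2
  rw [hju]
  congr 1
  linarith

/-- The Bregman distance of the total variation. -/
lemma bregman_totalVariation_coe [Fact (1 ≤ r)] {u φ : Lp ℝ r (volume.restrict Ω)}
    {p : StrongDual ℝ (Lp ℝ r (volume.restrict Ω))}
    (hu : totalVariation Ω r u = ((p u : ℝ) : EReal)) {M : ℝ}
    (hM : totalVariation Ω r φ = (M : EReal)) :
    bregman (totalVariation Ω r) p φ u = ((M - p φ : ℝ) : EReal) := by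
  rw [bregman, hu, hM, ← EReal.coe_sub, ← EReal.coe_sub, map_sub]
  congr 1
  ring

lemma bregman_totalVariation_top [Fact (1 ≤ r)] {u φ : Lp ℝ r (volume.restrict Ω)}
    {p : StrongDual ℝ (Lp ℝ r (volume.restrict Ω))}
    (hu : totalVariation Ω r u = ((p u : ℝ) : EReal)) (hM : totalVariation Ω r φ = ⊤) :
    bregman (totalVariation Ω r) p φ u = ⊤ := by
  rw [bregman, hu, hM, EReal.top_sub_coe, EReal.top_sub_coe]

lemma bregman_totalVariation_ne_bot [Fact (1 ≤ r)] {u φ : Lp ℝ r (volume.restrict Ω)}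
    {p : StrongDual ℝ (Lp ℝ r (volume.restrict Ω))}
    (hu : totalVariation Ω r u = ((p u : ℝ) : EReal)) :
    bregman (totalVariation Ω r) p φ u ≠ ⊥ := by
  by_cases h : totalVariation Ω r φ = ⊤
  · simp [bregman_totalVariation_top hu h]
  · rw [bregman_totalVariation_coe hu (EReal.coe_toReal h (totalVariation_ne_bot φ)).symm]
    exact EReal.coe_ne_bot _

lemma totalVariation_toLp_le [Fact (1 ≤ r)] (hΩ : IsOpen Ω) {v : EuclideanSpace ℝ (Fin n) → ℝ}
    (hv : ContDiffOn ℝ 1 v Ω) (hvr : MemLp v r (volume.restrict Ω))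
    (hgradv : Integrable (gradient v) (volume.restrict Ω)) :
    totalVariation Ω r (hvr.toLp v) ≤ ((∫ x in Ω, ‖gradient v x‖ : ℝ) : EReal) := by
  refine totalVariation_le_iff.2 fun q hq => ?_
  have : ∫ x in Ω, divergence q x * hvr.toLp v x = ∫ x in Ω, divergence q x * v x := by
    refine integral_congr_ae ?_
    filter_upwards [hvr.coeFn_toLp] with x hx
    rw [hx]
  rw [this, setIntegral_divergence_mul_eq hΩ hv (hq.1.of_le (by simp)) hq.2.1 hq.2.2.1,
    ← integral_neg]
  refine (Real.le_norm_self _).trans (norm_integral_le_of_norm_le hgradv.norm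
    (Eventually.of_forall fun x => ?_))
  rw [norm_neg]
  exact (norm_inner_le_norm _ _).trans (mul_le_of_le_one_right (norm_nonneg _) (hq.2.2.2 x))

end TotalVariationBasic

section Approximation

variable {n : ℕ} {Ω : Set (EuclideanSpace ℝ (Fin n))} {r : ENNReal} [Fact (1 ≤ r)]
  {g : EuclideanSpace ℝ (Fin n) → EuclideanSpace ℝ (Fin n)}

lemma integrable_inner_of_norm_le_one (hgm : AEStronglyMeasurable g (volume.restrict Ω))
    (hg1 : ∀ᵐ x ∂(volume.restrict Ω), ‖g x‖ ≤ 1)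
    {G : EuclideanSpace ℝ (Fin n) → EuclideanSpace ℝ (Fin n)}
    (hG : Integrable G (volume.restrict Ω)) :
    Integrable (fun x => inner ℝ (g x) (G x)) (volume.restrict Ω) := by
  refine hG.norm.mono (hgm.inner hG.1) ?_
  filter_upwards [hg1] with x hx
  rw [norm_norm]
  exact (norm_inner_le_norm _ _).trans (mul_le_of_le_one_left (norm_nonneg _) hx)

lemma integrable_one_sub_norm_mul (hgm : AEStronglyMeasurable g (volume.restrict Ω))
    (hg1 : ∀ᵐ x ∂(volume.restrict Ω), ‖g x‖ ≤ 1)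
    {G : EuclideanSpace ℝ (Fin n) → EuclideanSpace ℝ (Fin n)}
    (hG : Integrable G (volume.restrict Ω)) :
    Integrable (fun x => (1 - ‖g x‖) * ‖G x‖) (volume.restrict Ω) := by
  refine hG.norm.mono ((aestronglyMeasurable_const.sub hgm.norm).mul hG.1.norm) ?_
  filter_upwards [hg1] with x hx
  rw [norm_mul, norm_norm]
  refine mul_le_of_le_one_left (norm_nonneg _) ?_
  rw [Real.norm_eq_abs, abs_le]
  constructor <;> linarith [norm_nonneg (g x)]

lemma stronglyMeasurable_indicator_of_contDiffOn (hΩ : IsOpen Ω)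
    {v : EuclideanSpace ℝ (Fin n) → ℝ} (hv : ContDiffOn ℝ 1 v Ω) :
    StronglyMeasurable (Ω.indicator v) := by
  classical
  rw [← piecewise_eq_indicator]
  exact (hv.continuousOn.measurable_piecewise continuousOn_const
    hΩ.measurableSet).stronglyMeasurable

lemma gradient_indicator_eqOn (hΩ : IsOpen Ω) (v : EuclideanSpace ℝ (Fin n) → ℝ) :
    EqOn (gradient (Ω.indicator v)) (gradient v) Ω := fun _ hx =>
  Filter.EventuallyEq.gradient_eq ((eqOn_indicator (s := Ω) (f := v)).eventuallyEq_of_mem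
    (hΩ.mem_nhds hx))

lemma tendsto_integral_inner_of_tendsto (hgm : AEStronglyMeasurable g (volume.restrict Ω))
    (hg1 : ∀ᵐ x ∂(volume.restrict Ω), ‖g x‖ ≤ 1)
    {G : ℕ → EuclideanSpace ℝ (Fin n) → EuclideanSpace ℝ (Fin n)}
    {G₀ : EuclideanSpace ℝ (Fin n) → EuclideanSpace ℝ (Fin n)}
    (hG : ∀ k, Integrable (G k) (volume.restrict Ω)) (hG₀ : Integrable G₀ (volume.restrict Ω))
    (h : Tendsto (fun k => eLpNorm (G k - G₀) 1 (volume.restrict Ω)) atTop (𝓝 0)) :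
    Tendsto (fun k => ∫ x in Ω, inner ℝ (g x) (G k x)) atTop
      (𝓝 (∫ x in Ω, inner ℝ (g x) (G₀ x))) := by
  refine tendsto_integral_of_L1' _ (hgm.inner hG₀.1)
    (Eventually.of_forall fun k => integrable_inner_of_norm_le_one hgm hg1 (hG k)) ?_
  refine tendsto_of_tendsto_of_tendsto_of_le_of_le tendsto_const_nhds h (fun _ => zero_le)
    fun k => eLpNorm_mono_ae ?_
  filter_upwards [hg1] with x hx
  simp only [Pi.sub_apply, ← inner_sub_right]
  exact (norm_inner_le_norm _ _).trans (mul_le_of_le_one_left (norm_nonneg _) hx)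

lemma tendsto_integral_one_sub_norm_mul_of_tendsto
    (hgm : AEStronglyMeasurable g (volume.restrict Ω))
    (hg1 : ∀ᵐ x ∂(volume.restrict Ω), ‖g x‖ ≤ 1)
    {G : ℕ → EuclideanSpace ℝ (Fin n) → EuclideanSpace ℝ (Fin n)}
    {G₀ : EuclideanSpace ℝ (Fin n) → EuclideanSpace ℝ (Fin n)}
    (hG : ∀ k, Integrable (G k) (volume.restrict Ω)) (hG₀ : Integrable G₀ (volume.restrict Ω))
    (h : Tendsto (fun k => eLpNorm (G k - G₀) 1 (volume.restrict Ω)) atTop (𝓝 0)) :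
    Tendsto (fun k => ∫ x in Ω, (1 - ‖g x‖) * ‖G k x‖) atTop
      (𝓝 (∫ x in Ω, (1 - ‖g x‖) * ‖G₀ x‖)) := by
  refine tendsto_integral_of_L1' _ (integrable_one_sub_norm_mul hgm hg1 hG₀).1
    (Eventually.of_forall fun k => integrable_one_sub_norm_mul hgm hg1 (hG k)) ?_
  refine tendsto_of_tendsto_of_tendsto_of_le_of_le tendsto_const_nhds h (fun _ => zero_le)
    fun k => eLpNorm_mono_ae ?_
  filter_upwards [hg1] with x hx
  simp only [Pi.sub_apply, ← mul_sub]
  rw [norm_mul]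
  have h1 : ‖1 - ‖g x‖‖ ≤ 1 := by
    rw [Real.norm_eq_abs, abs_le]
    constructor <;> linarith [norm_nonneg (g x)]
  exact (mul_le_of_le_one_left (norm_nonneg _) h1).trans (abs_norm_sub_norm_le _ _)

/-- The divergence formula extends from smooth functions to functions in `C^1(Ω)`. -/
lemma IsDivergenceOf.apply_toLp_of_contDiffOn_one (hΩ : IsOpen Ω) (hr : r ≠ ⊤)
    {p : StrongDual ℝ (Lp ℝ r (volume.restrict Ω))} (hpg : IsDivergenceOf Ω r p g)
    (hgm : AEStronglyMeasurable g (volume.restrict Ω))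
    (hg1 : ∀ᵐ x ∂(volume.restrict Ω), ‖g x‖ ≤ 1)
    {v : EuclideanSpace ℝ (Fin n) → ℝ} (hv : ContDiffOn ℝ 1 v Ω)
    (hvr : MemLp v r (volume.restrict Ω)) (hgradv : Integrable (gradient v) (volume.restrict Ω)) :
    p (hvr.toLp v) = -∫ x in Ω, inner ℝ (g x) (gradient v x) := by
  obtain ⟨c, δ, hδ, hc⟩ := exists_isScale hΩ
  set w := Ω.indicator v with hw
  have hwm : StronglyMeasurable w := stronglyMeasurable_indicator_of_contDiffOn hΩ hv
  have hwr : MemLp w r volume := (memLp_indicator_iff_restrict hΩ.measurableSet).2 hvr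
  have hwl : LocallyIntegrable w := hwr.locallyIntegrable Fact.out
  have hweq : w =ᵐ[volume.restrict Ω] v := indicator_ae_eq_restrict hΩ.measurableSet
  have hgeq : gradient w =ᵐ[volume.restrict Ω] gradient v :=
    (ae_restrict_iff' hΩ.measurableSet).2
      (Eventually.of_forall fun x hx => gradient_indicator_eqOn hΩ v hx)
  have hw1 : ContDiffOn ℝ 1 w Ω := hv.congr fun x hx => indicator_of_mem hx v
  have hgw : Integrable (gradient w) (volume.restrict Ω) := hgradv.congr hgeq.symm
  obtain ⟨hi, hlim⟩ := tendsto_gradient_variableMollify hΩ hδ hc hwm hwl hw1 hgw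
  have hk : ∀ k, MemLp (variableMollify (δ k) w) r (volume.restrict Ω) := fun k =>
    (memLp_variableMollify (hδ k).lipschitz (hδ k).lt_one hwm Fact.out hr hwr).restrict Ω
  have h1 := tendsto_dual_variableMollify hδ hc hr p hwm hwr hk (hwr.restrict Ω)
  have h2 := (tendsto_integral_inner_of_tendsto hgm hg1 hi hgw hlim).neg
  have h3 : ∀ k, p ((hk k).toLp _) =
      -∫ x in Ω, inner ℝ (g x) (gradient (variableMollify (δ k) w) x) := fun k =>
    hpg _ (hk k) (contDiffOn_variableMollify (hδ k).contDiff (hδ k).pos hwl) (hi k)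
  simp only [h3] at h1
  have h4 := tendsto_nhds_unique h1 h2
  rw [MemLp.toLp_congr (hwr.restrict Ω) hvr hweq] at h4
  rw [h4]
  congr 1
  refine integral_congr_ae ?_
  filter_upwards [hgeq] with x hx
  rw [hx]

/-- The lower bound for decompositions of `v` into functions of bounded variation. -/
lemma integral_one_sub_norm_mul_le (hΩ : IsOpen Ω) (hr : r ≠ ⊤)
    {p : StrongDual ℝ (Lp ℝ r (volume.restrict Ω))} (hpg : IsDivergenceOf Ω r p g)
    (hgm : AEStronglyMeasurable g (volume.restrict Ω))
    (hg1 : ∀ᵐ x ∂(volume.restrict Ω), ‖g x‖ ≤ 1)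
    {v : EuclideanSpace ℝ (Fin n) → ℝ} (hv : ContDiffOn ℝ 1 v Ω)
    (hvr : MemLp v r (volume.restrict Ω)) (hgradv : Integrable (gradient v) (volume.restrict Ω))
    {φ ψ : Lp ℝ r (volume.restrict Ω)} (hsum : hvr.toLp v = φ + ψ) {M N : ℝ}
    (hM : totalVariation Ω r φ = (M : EReal)) (hN : totalVariation Ω r ψ = (N : EReal)) :
    ∫ x in Ω, (1 - ‖g x‖) * ‖gradient v x‖ ≤ (M - p φ) + (N + p ψ) := by
  obtain ⟨c, δ, hδ, hc⟩ := exists_isScale hΩ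
  have hΩm := hΩ.measurableSet
  set w := Ω.indicator v with hw
  have hwm : StronglyMeasurable w := stronglyMeasurable_indicator_of_contDiffOn hΩ hv
  have hwr : MemLp w r volume := (memLp_indicator_iff_restrict hΩm).2 hvr
  have hwl : LocallyIntegrable w := hwr.locallyIntegrable Fact.out
  have hgeq : gradient w =ᵐ[volume.restrict Ω] gradient v :=
    (ae_restrict_iff' hΩm).2
      (Eventually.of_forall fun x hx => gradient_indicator_eqOn hΩ v hx)
  have hw1 : ContDiffOn ℝ 1 w Ω := hv.congr fun x hx => indicator_of_mem hx v
  have hgw : Integrable (gradient w) (volume.restrict Ω) := hgradv.congr hgeq.symm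
  obtain ⟨hi, hlim⟩ := tendsto_gradient_variableMollify hΩ hδ hc hwm hwl hw1 hgw
  set A : ℕ → ℝ := fun k => (1 + c k) * ((1 - c k)⁻¹ : ℝ≥0) ^ n with hA
  have hAlim : Tendsto A atTop (𝓝 1) := by
    have h1 : Tendsto (fun k => (1 - c k)⁻¹) atTop (𝓝 ((1 - 0)⁻¹ : ℝ≥0)) :=
      (hc.const_sub 1).inv₀ (by simp)
    have h2 := ((NNReal.tendsto_coe.2 hc).const_add 1).mul ((NNReal.tendsto_coe.2 h1).pow n)
    simpa [hA] using h2
  have key : ∀ (ξ : Lp ℝ r (volume.restrict Ω)) (L : ℝ), totalVariation Ω r ξ = (L : EReal) →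
      LocallyIntegrable (Ω.indicator ξ) ∧
      (∀ k, ContDiffOn ℝ ∞ (variableMollify (δ k) (Ω.indicator ξ)) Ω) ∧
      (∀ k, Integrable (gradient (variableMollify (δ k) (Ω.indicator ξ))) (volume.restrict Ω)) ∧
      (∀ k, ∫ x in Ω, ‖gradient (variableMollify (δ k) (Ω.indicator ξ)) x‖ ≤ A k * L) ∧
      Tendsto (fun k => ∫ x in Ω, inner ℝ (g x)
        (gradient (variableMollify (δ k) (Ω.indicator ξ)) x)) atTop (𝓝 (-p ξ)) := by
    intro ξ L hL
    have hm : StronglyMeasurable (Ω.indicator ξ) := (Lp.stronglyMeasurable ξ).indicator hΩm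
    have hmem : MemLp (Ω.indicator ξ) r volume :=
      (memLp_indicator_iff_restrict hΩm).2 (Lp.memLp ξ)
    have hloc : LocallyIntegrable (Ω.indicator ξ) := hmem.locallyIntegrable Fact.out
    have hsm : ∀ k, ContDiffOn ℝ ∞ (variableMollify (δ k) (Ω.indicator ξ)) Ω := fun k =>
      contDiffOn_variableMollify (hδ k).contDiff (hδ k).pos hloc
    have hL0 : 0 ≤ L := by
      have := totalVariation_nonneg ξ
      rw [hL] at this
      exact_mod_cast this
    have htest : ∀ q ∈ testFields Ω, ∫ x in Ω, divergence q x * Ω.indicator ξ x ≤ L := by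
      intro q hq
      refine le_trans (le_of_eq ?_) (totalVariation_le_iff.1 hL.le q hq)
      exact setIntegral_congr_fun hΩm fun x hx => by simp only [indicator_of_mem hx]
    have hgr := fun k => integral_norm_gradient_variableMollify_le hΩ (hδ k) hr hm hmem hL0 htest
    have hk : ∀ k, MemLp (variableMollify (δ k) (Ω.indicator ξ)) r (volume.restrict Ω) := fun k =>
      (memLp_variableMollify (hδ k).lipschitz (hδ k).lt_one hm Fact.out hr hmem).restrict Ω
    refine ⟨hloc, hsm, fun k => (hgr k).1, fun k => (hgr k).2.trans_eq (by simp only [hA]; ring),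
      ?_⟩
    have h1 := (tendsto_dual_variableMollify hδ hc hr p hm hmem hk (hmem.restrict Ω)).neg
    have h2 : (hmem.restrict Ω).toLp (Ω.indicator ξ) = ξ := by
      rw [MemLp.toLp_congr (hmem.restrict Ω) (Lp.memLp ξ) (indicator_ae_eq_restrict hΩm),
        Lp.toLp_coeFn]
    rw [h2] at h1
    refine h1.congr fun k => ?_
    rw [hpg _ (hk k) (hsm k) (hgr k).1, neg_neg]
  obtain ⟨φl, φs, φi, φb, φt⟩ := key φ M hM
  obtain ⟨ψl, ψs, ψi, ψb, ψt⟩ := key ψ N hN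
  have hadd : w =ᵐ[volume] Ω.indicator φ + Ω.indicator ψ := by
    have h1 : v =ᵐ[volume.restrict Ω] fun x => φ x + ψ x := by
      filter_upwards [hvr.coeFn_toLp, Lp.coeFn_add φ ψ] with x hx hx'
      rw [← hx, hsum, hx', Pi.add_apply]
    rw [Filter.EventuallyEq, ae_restrict_iff' hΩm] at h1
    filter_upwards [h1] with x hx
    by_cases hxΩ : x ∈ Ω
    · simp [hw, hxΩ, hx hxΩ]
    · simp [hw, hxΩ]
  have hmol : ∀ k, EqOn (variableMollify (δ k) w)
      (variableMollify (δ k) (Ω.indicator φ) + variableMollify (δ k) (Ω.indicator ψ)) Ω := by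
    intro k x hx
    have hne : δ k x ≠ 0 := ((hδ k).pos x hx).1.ne'
    rw [variableMollify_congr_ae hadd hne]
    exact integral_add (integrable_mollifier_comp φl x _) (integrable_mollifier_comp ψl x _)
  have hgrad : ∀ k, ∀ x ∈ Ω, gradient (variableMollify (δ k) w) x =
      gradient (variableMollify (δ k) (Ω.indicator φ)) x +
        gradient (variableMollify (δ k) (Ω.indicator ψ)) x := by
    intro k x hx
    have hd1 := (((φs k).contDiffAt (hΩ.mem_nhds hx)).differentiableAt (by simp))
    have hd2 := (((ψs k).contDiffAt (hΩ.mem_nhds hx)).differentiableAt (by simp))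
    rw [((hmol k).eventuallyEq_of_mem (hΩ.mem_nhds hx)).gradient_eq]
    refine ext_inner_right ℝ fun e => ?_
    rw [inner_add_left, inner_gradient_left, inner_gradient_left, inner_gradient_left,
      fderiv_add hd1 hd2, add_apply]
  have hle : ∀ k, ∫ x in Ω, (1 - ‖g x‖) * ‖gradient (variableMollify (δ k) w) x‖ ≤
      (A k * M + ∫ x in Ω, inner ℝ (g x) (gradient (variableMollify (δ k) (Ω.indicator φ)) x)) +
      (A k * N - ∫ x in Ω, inner ℝ (g x)
        (gradient (variableMollify (δ k) (Ω.indicator ψ)) x)) := by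
    intro k
    have i1 := integrable_inner_of_norm_le_one hgm hg1 (φi k)
    have i2 := integrable_inner_of_norm_le_one hgm hg1 (ψi k)
    refine le_trans ?_ (add_le_add (add_le_add_left (φb k) _) (sub_le_sub_right (ψb k) _))
    have hadd' := integral_add ((φi k).norm.add i1) ((ψi k).norm.sub i2)
    simp only [Pi.add_apply, Pi.sub_apply] at hadd'
    rw [← integral_add (φi k).norm i1, ← integral_sub (ψi k).norm i2, ← hadd']
    refine integral_mono_ae (integrable_one_sub_norm_mul hgm hg1 (hi k))
      (((φi k).norm.add i1).add ((ψi k).norm.sub i2)) ?_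
    filter_upwards [hg1, ae_restrict_mem hΩm] with x hgx hx
    simp only [hgrad k x hx]
    set a := gradient (variableMollify (δ k) (Ω.indicator φ)) x
    set b := gradient (variableMollify (δ k) (Ω.indicator ψ)) x
    have h1 : (1 - ‖g x‖) * ‖a + b‖ ≤ (1 - ‖g x‖) * (‖a‖ + ‖b‖) :=
      mul_le_mul_of_nonneg_left (norm_add_le _ _) (by linarith)
    have h2 := (abs_le.1 (abs_real_inner_le_norm (g x) a)).1
    have h3 := (abs_le.1 (abs_real_inner_le_norm (g x) b)).2
    nlinarith
  have hL := tendsto_integral_one_sub_norm_mul_of_tendsto hgm hg1 hi hgw hlim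
  have hR := ((hAlim.mul_const M).add φt).add ((hAlim.mul_const N).sub ψt)
  have := le_of_tendsto_of_tendsto' hL hR hle
  have heq : ∫ x in Ω, (1 - ‖g x‖) * ‖gradient w x‖ = ∫ x in Ω, (1 - ‖g x‖) * ‖gradient v x‖ := by
    refine integral_congr_ae ?_
    filter_upwards [hgeq] with x hx
    rw [hx]
  rw [heq] at this
  linarith

end Approximation

end TVBregman

theorem mainTheorem8 {n : ℕ} (Ω : Set (EuclideanSpace ℝ (Fin n))) (hΩ : IsOpen Ω)
    (r : ENNReal) [Fact (1 ≤ r)] (hr : r ≠ ⊤)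
    (v : EuclideanSpace ℝ (Fin n) → ℝ) (hv : ContDiffOn ℝ 1 v Ω)
    (hvr : MemLp v r (volume.restrict Ω))
    (hgradv : Integrable (gradient v) (volume.restrict Ω))
    (u : Lp ℝ r (volume.restrict Ω))
    (p : StrongDual ℝ (Lp ℝ r (volume.restrict Ω)))
    (hp : p ∈ TVBregman.subdifferential (TVBregman.totalVariation Ω r) u)
    (g : EuclideanSpace ℝ (Fin n) → EuclideanSpace ℝ (Fin n))
    (hgm : AEStronglyMeasurable g (volume.restrict Ω))
    (hg1 : ∀ᵐ x ∂(volume.restrict Ω), ‖g x‖ ≤ 1)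
    (hpg : TVBregman.IsDivergenceOf Ω r p g) :
    ((∫ x in Ω, (1 - ‖g x‖) * ‖gradient v x‖ : ℝ) : EReal) ≤
        TVBregman.infConv
          (fun φ => TVBregman.bregman (TVBregman.totalVariation Ω r) p φ u)
          (fun ψ => TVBregman.bregman (TVBregman.totalVariation Ω r) (-p) ψ (-u))
          (hvr.toLp v) ∧
      TVBregman.infConv
          (fun φ => TVBregman.bregman (TVBregman.totalVariation Ω r) p φ u)
          (fun ψ => TVBregman.bregman (TVBregman.totalVariation Ω r) (-p) ψ (-u))
          (hvr.toLp v) ≤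
        (((∫ x in Ω, ‖gradient v x‖) - |∫ x in Ω, inner ℝ (gradient v x) (g x)| : ℝ) : EReal) := by
  have hu := TVBregman.totalVariation_eq_of_mem_subdifferential hp
  have hu' : TVBregman.totalVariation Ω r (-u) = (((-p) (-u) : ℝ) : EReal) := by
    rw [TVBregman.totalVariation_neg, hu]
    simp
  constructor
  · refine le_iInf fun φ => le_iInf fun ψ => le_iInf fun hsum => ?_
    beta_reduce
    by_cases hφ : TVBregman.totalVariation Ω r φ = ⊤
    · rw [TVBregman.bregman_totalVariation_top hu hφ,
        EReal.top_add_of_ne_bot (TVBregman.bregman_totalVariation_ne_bot hu')]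
      exact le_top
    by_cases hψ : TVBregman.totalVariation Ω r ψ = ⊤
    · rw [TVBregman.bregman_totalVariation_top hu' hψ,
        EReal.add_top_of_ne_bot (TVBregman.bregman_totalVariation_ne_bot hu)]
      exact le_top
    have hM := (EReal.coe_toReal hφ (TVBregman.totalVariation_ne_bot φ)).symm
    have hN := (EReal.coe_toReal hψ (TVBregman.totalVariation_ne_bot ψ)).symm
    rw [TVBregman.bregman_totalVariation_coe hu hM, TVBregman.bregman_totalVariation_coe hu' hN,
      ← EReal.coe_add, EReal.coe_le_coe_iff, neg_apply, sub_neg_eq_add]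
    exact TVBregman.integral_one_sub_norm_mul_le hΩ hr hpg hgm hg1 hv hvr hgradv hsum hM hN
  · have hpv : p (hvr.toLp v) = -∫ x in Ω, inner ℝ (gradient v x) (g x) := by
      rw [hpg.apply_toLp_of_contDiffOn_one hΩ hr hgm hg1 hv hvr hgradv]
      simp only [real_inner_comm]
    have hJv := TVBregman.totalVariation_toLp_le hΩ hv hvr hgradv
    have hJt : TVBregman.totalVariation Ω r (hvr.toLp v) ≠ ⊤ :=
      (hJv.trans_lt (EReal.coe_lt_top _)).ne
    have hM := (EReal.coe_toReal hJt (TVBregman.totalVariation_ne_bot _)).symm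
    rw [hM, EReal.coe_le_coe_iff] at hJv
    have hJ0 : TVBregman.totalVariation Ω r 0 = ((0 : ℝ) : EReal) :=
      le_antisymm TVBregman.totalVariation_zero_le (TVBregman.totalVariation_nonneg 0)
    rcases le_total 0 (p (hvr.toLp v)) with h | h
    · refine (TVBregman.infConv_le _ _ (add_zero _).symm).trans ?_
      beta_reduce
      rw [TVBregman.bregman_totalVariation_coe hu hM, TVBregman.bregman_totalVariation_coe hu' hJ0,
        ← EReal.coe_add, EReal.coe_le_coe_iff, map_zero, sub_zero, add_zero,
        ← abs_neg, ← hpv, abs_of_nonneg h]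
      linarith
    · refine (TVBregman.infConv_le _ _ (zero_add _).symm).trans ?_
      beta_reduce
      rw [TVBregman.bregman_totalVariation_coe hu hJ0, TVBregman.bregman_totalVariation_coe hu' hM,
        ← EReal.coe_add, EReal.coe_le_coe_iff, map_zero, sub_zero, zero_add,
        neg_apply, ← abs_neg, ← hpv, abs_of_nonpos h]
      linarith
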